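/- Let $p$ be a prime, let $k$ be an algebraically closed field of characteristic $p$, and let $W(k)$ be its ring of ($p$-typical) Witt vectors, so that $W(k)/pW(k)=k$. Let $A$ and $B$ be finite-dimensional semisimple and cosemisimple Hopf algebras over $k$ (cosemisimple means that the dual algebra $A^*=\mathrm{Hom}_k(A,k)$, respectively $B^*$, is semisimple), and let $\phi:A\to B$ be a homomorphism of Hopf algebras. Let $\bar A$ and $\bar B$ be liftings of $A$ and $B$ to $W(k)$, that is, Hopf algebras over $W(k)$ which are free of finite rank as $W(k)$-modules, together with identifications $\bar A/p\bar A\cong A$ and $\bar B/p\bar B\cong B$ of Hopf algebras over $k$. Then there exists a unique homomorphism $\bar\phi:\bar A\to\bar B$ of Hopf algebras over $W(k)$ such that $\bar\phi=\phi$ modulo $p$; that is, under these identifications, the map $\bar A/p\bar A\to\bar B/p\bar B$ induced by $\bar\phi$ is $\phi$. -/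

import Mathlib

open scoped TensorProduct

/-- The residue map `W(k) → k`, `x ↦ x mod p`, makes `k` an algebra over its ring of Witt
vectors. -/
noncomputable instance wittResidueAlgebra (p : ℕ) [Fact p.Prime] (k : Type*) [CommRing k] :
    Algebra (WittVector p k) k :=
  (WittVector.constantCoeff : WittVector p k →+* k).toAlgebra

/-- A finite-dimensional coalgebra `C` over a field `k` is cosemisimple if its dual algebra
`C* = Hom_k(C, k)`, with the convolution product `(f * g)(c) = ∑ f(c₍₁₎) g(c₍₂₎)` and unit the
counit of `C`, is a semisimple ring. -/
def IsCosemisimple (k C : Type*) [Field k] [AddCommGroup C] [Module k C] [Coalgebra k C]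
    [Module.Finite k C] : Prop :=
  IsSemisimpleRing (WithConv (C →ₗ[k] k))

/-- A Hopf algebra lifting of the `k`-Hopf algebra `A` to `W(k)`: the Hopf algebra `L` over `W(k)`
is a free module of finite rank, and its reduction `L/pL = k ⊗ L` (tensor product over `W(k)`) is
identified with `A` as a Hopf algebra over `k`. The rank of `L` is then the dimension of `A`. -/
structure HopfLifting (p : ℕ) [Fact p.Prime] (k : Type*) [Field k]
    (A : Type*) [Ring A] [HopfAlgebra k A]
    (L : Type*) [Ring L] [HopfAlgebra (WittVector p k) L] where
  free : Module.Free (WittVector p k) L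
  finite : Module.Finite (WittVector p k) L
  equiv : (k ⊗[WittVector p k] L) ≃ₐc[k] A

/-- The reduction modulo `p` of an element of a lifting, as an element of the original Hopf
algebra. -/
noncomputable def HopfLifting.red {p : ℕ} [Fact p.Prime] {k : Type*} [Field k]
    {A : Type*} [Ring A] [HopfAlgebra k A]
    {L : Type*} [Ring L] [HopfAlgebra (WittVector p k) L]
    (l : HopfLifting p k A L) (x : L) : A :=
  l.equiv ((1 : k) ⊗ₜ[WittVector p k] x)

/-- A homomorphism of Hopf algebras over `R`: a map that respects the algebra and the coalgebra
structures and commutes with the antipodes. -/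
structure HopfHom (R H H' : Type*) [CommRing R] [Ring H] [Ring H'] [HopfAlgebra R H]
    [HopfAlgebra R H'] extends H →ₐc[R] H' where
  map_antipode : ∀ x : H, toBialgHom (HopfAlgebra.antipode R x) =
    HopfAlgebra.antipode R (toBialgHom x)

/-!
The homomorphism is lifted one power of `p` at a time, and the deformation theory of Hopf algebra
homomorphisms `φ : A → B` that this requires vanishes for a simple reason. It takes place in the
complexes `Hom(A^{⊗m}, B^{⊗n})` with the Hochschild differential in the direction of `A` and the
cobar differential in the direction of `B`.

In the direction of `A`, semisimplicity provides an integral `Λ` with `ε(Λ) = 1`, and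
`∑ Λ₍₁₎ ⊗ S(Λ₍₂₎)` is a separability idempotent of `A`. Hence Hochschild 2-cocycles are coboundaries
(`exists_eq_hochschild_coboundary`) and derivations are inner (`exists_eq_commutator_of_leibniz`).
Multiplicativity can therefore be lifted, and what remains are elements of `B^{⊗n}` modulo the
centralizer of the image of `A`.

In the direction of `B`, cosemisimplicity provides an integral `lam ∈ B*` with `lam 1 = 1`, and
contraction of the first tensor factor with `lam` is a contracting homotopy of the cobar complex of
`B`. The point is that this contraction preserves the centralizers of `A`
(`IsAdInvariantIntegral.applyLeft_commute`), because `lam` is invariant under the adjoint action of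
`B` (`integral_adjoint_invariant`). Invariance comes from the formula `lam (x y) = lam (S²(y) x)`,
in which both semisimplicity and cosemisimplicity of `B` enter: the normalized integrals of `B` and
`B*` pair nontrivially, because `lam(Λ) Tr(S²) = ε(Λ) lam(1) = 1`
(`integral_apply_integral_ne_zero`). The resulting vanishing statements in degrees one and two are
`eq_zero_of_leibniz_of_coleibniz` and `exists_leibniz_eq_coboundary`.

The ring `W(k)` is `p`-adically complete with residue field `k`. The degree two statement corrects a
lift modulo `p ^ n` to one modulo `p ^ (n + 1)`, so a lift exists in the limit
(`exists_bialgHom_lift`), and the degree one statement shows that two lifts agree modulo every power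
of `p` (`bialgHom_ext_of_reduction`). Compatibility with unit, counit and antipode is automatic.
-/

open scoped TensorProduct
open Coalgebra HopfAlgebra

/-! ### Integrals and the Frobenius structure -/

/-- In a semisimple algebra the kernel of an augmentation `χ` has a complementary left ideal, and
the component of `1` in it is a left integral `e` with `χ e = 1`. A right integral obtained in the
same way from the opposite algebra must coincide with `e`. -/
theorem exists_augmentation_integral {k R : Type*} [Field k] [Ring R] [Algebra k R]
    [IsSemisimpleRing R] (χ : R →ₐ[k] k) :
    ∃ e : R, χ e = 1 ∧ (∀ a, a * e = χ a • e) ∧ ∀ a, e * a = χ a • e := by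
  have left : ∀ (Q : Type _) [Ring Q] [Algebra k Q] [IsSemisimpleRing Q] (ξ : Q →ₐ[k] k),
      ∃ e : Q, ξ e = 1 ∧ ∀ a, a * e = ξ a • e := by
    intro Q _ _ _ ξ
    obtain ⟨J, hJ⟩ := exists_isCompl (RingHom.ker ξ : Submodule Q Q)
    have h1 : (1 : Q) ∈ (RingHom.ker ξ : Submodule Q Q) ⊔ J := hJ.sup_eq_top ▸ Submodule.mem_top
    obtain ⟨x, hx, e, he, hxe⟩ := Submodule.mem_sup.1 h1
    have hx' : ξ x = 0 := hx
    have hξ : ξ e = 1 := by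
      have := congrArg ξ hxe
      simpa [hx'] using this
    refine ⟨e, hξ, fun a ↦ ?_⟩
    rw [← sub_eq_zero]
    refine (Submodule.disjoint_def.1 hJ.disjoint) _ ?_ ?_
    · change ξ _ = 0
      simp [hξ]
    · refine J.sub_mem (J.smul_mem a he) ?_
      rw [Algebra.smul_def]
      exact J.smul_mem _ he
  obtain ⟨e, he, hl⟩ := left R χ
  obtain ⟨f, hf, hr⟩ := left Rᵐᵒᵖ ((AlgHom.fromOpposite χ (fun _ _ ↦ Commute.all _ _)))
  have hr' : ∀ a, f.unop * a = χ a • f.unop := fun a ↦ by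
    have := congrArg MulOpposite.unop (hr (MulOpposite.op a))
    simpa using this
  have hf' : χ f.unop = 1 := by simpa using hf
  have hef : f.unop = e := by
    have h1 := hl f.unop
    have h2 := hr' e
    rw [hf', one_smul] at h1
    rw [he, one_smul] at h2
    rw [← h1, h2]
  exact ⟨e, he, hl, fun a ↦ hef ▸ hr' a⟩

section Frobenius

variable {k A : Type*} [CommRing k] [Ring A] [HopfAlgebra k A]

theorem sum_counit_right_smul_left {C ι : Type*} [AddCommGroup C] [Module k C] [Coalgebra k C]
    {a : C} (r : Coalgebra.Repr k a ι) :
    ∑ i ∈ r.index, counit (R := k) (r.right i) • r.left i = a := by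
  have := congrArg (TensorProduct.rid k C) (sum_tmul_counit_eq r)
  simpa only [map_sum, TensorProduct.rid_tmul, one_smul] using this

variable (k) in
/-- The element `(id ⊗ S)(Δ Λ) = ∑ Λ₍₁₎ ⊗ S(Λ₍₂₎)` of `A ⊗ A`. If `Λ` is a left integral with
`ε(Λ) = 1`, it is a separability idempotent of `A`. -/
noncomputable def casimir (Λ : A) : A ⊗[k] A := (antipode k (A := A)).lTensor A (comul Λ)

theorem mul'_casimir (Λ : A) :
    LinearMap.mul' k A (casimir k Λ) = algebraMap k A (counit Λ) :=
  mul_antipode_lTensor_comul_apply Λ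

theorem tmul_one_mul_casimir {Λ : A} (hΛ : ∀ a : A, a * Λ = counit (R := k) a • Λ) (a : A) :
    (a ⊗ₜ[k] (1 : A)) * casimir k Λ = casimir k Λ * ((1 : A) ⊗ₜ[k] a) := by
  -- Both sides are values of the map `p ⊗ q ⊗ s ↦ (p ⊗ 1) (∑ Λ₍₁₎ ⊗ S(Λ₍₂₎)) (1 ⊗ S(q) s)` on the
  -- two iterated comultiplications of `a`.
  have key : ∀ (b c : A) (r : Coalgebra.Repr k b (A × A)),
      (antipode k (A := A)).lTensor A (comul (b * Λ)) * ((1 : A) ⊗ₜ[k] c)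
        = ∑ i ∈ r.index, (r.left i ⊗ₜ[k] (1 : A)) * casimir k Λ *
            ((1 : A) ⊗ₜ[k] (antipode k (r.right i) * c)) := by
    intro b c r
    have : ∀ z : A ⊗[k] A, ∀ x y : A,
        (antipode k (A := A)).lTensor A ((x ⊗ₜ y) * z) * ((1 : A) ⊗ₜ[k] c) =
        (x ⊗ₜ[k] (1 : A)) * (antipode k (A := A)).lTensor A z *
            ((1 : A) ⊗ₜ[k] (antipode k y * c)) := by
      intro z x y
      induction z with
      | zero => simp
      | tmul p q => simp [antipode_mul_antidistrib, mul_assoc]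
      | add p q hp hq => simp only [mul_add, map_add, add_mul, hp, hq]
    rw [Bialgebra.comul_mul, ← r.eq, Finset.sum_mul, map_sum, Finset.sum_mul]
    exact Finset.sum_congr rfl fun i _ ↦ this _ _ _
  let r := Coalgebra.Repr.arbitrary k a
  let F : A ⊗[k] (A ⊗[k] A) →ₗ[k] A ⊗[k] A :=
    TensorProduct.lift (((LinearMap.mul k (A ⊗[k] A)).flip.comp
      ((TensorProduct.mk k A A 1) ∘ₗ LinearMap.mul' k A ∘ₗ (antipode k).rTensor A)).flip.comp
      ((LinearMap.mul k (A ⊗[k] A)).flip (casimir k Λ) ∘ₗ (TensorProduct.mk k A A).flip 1))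
  have hF : ∀ p q s : A, F (p ⊗ₜ (q ⊗ₜ s)) = (p ⊗ₜ[k] (1 : A)) * casimir k Λ *
            ((1 : A) ⊗ₜ[k] (antipode k q * s)) := fun p q s ↦ by
    simp [F]
  have e1 : F (comul.lTensor A (comul a)) = (a ⊗ₜ[k] (1 : A)) * casimir k Λ := by
    have : ∀ p b : A, F (p ⊗ₜ comul b) = (counit (R := k) b • p) ⊗ₜ[k] (1 : A) * casimir k Λ := by
      intro p b
      let s := Coalgebra.Repr.arbitrary k b
      rw [← s.eq, TensorProduct.tmul_sum, map_sum]
      simp_rw [hF]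
      rw [← Finset.mul_sum, ← TensorProduct.tmul_sum, sum_antipode_mul_eq_smul]
      simp [← Algebra.TensorProduct.one_def, ← TensorProduct.smul_tmul']
    rw [← r.eq, map_sum, map_sum]
    simp_rw [LinearMap.lTensor_tmul, this]
    rw [← Finset.sum_mul, ← TensorProduct.sum_tmul]
    rw [sum_counit_right_smul_left]
  have e2 : F (comul.lTensor A (comul a)) = casimir k Λ * ((1 : A) ⊗ₜ[k] a) := by
    rw [← coassoc_apply, ← r.eq]
    simp only [map_sum, LinearMap.rTensor_tmul]
    have : ∀ i, F (TensorProduct.assoc k A A A (comul (r.left i) ⊗ₜ r.right i)) =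
        counit (R := k) (r.left i) • casimir k Λ * ((1 : A) ⊗ₜ[k] r.right i) := by
      intro i
      let s := Coalgebra.Repr.arbitrary k (r.left i)
      rw [← s.eq, TensorProduct.sum_tmul, map_sum, map_sum]
      simp_rw [TensorProduct.assoc_tmul, hF]
      rw [← key, hΛ, map_smul, map_smul, casimir]
    simp_rw [this, smul_mul_assoc, ← mul_smul_comm, ← TensorProduct.tmul_smul]
    rw [← Finset.mul_sum, ← TensorProduct.tmul_sum, sum_counit_smul]
  rw [← e1, e2]

theorem casimir_mul_tmul_one {Λ : A} (hΛ : ∀ a : A, Λ * a = counit (R := k) a • Λ) (a : A) :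
    casimir k Λ * (a ⊗ₜ[k] (1 : A)) =
      ((1 : A) ⊗ₜ[k] antipode k (antipode k a)) * casimir k Λ := by
  -- Both sides are values of the map `p ⊗ q ⊗ s ↦ (1 ⊗ S²(s) S(q)) (∑ Λ₍₁₎ ⊗ S(Λ₍₂₎)) (p ⊗ 1)` on
  -- the two iterated comultiplications of `a`.
  have key : ∀ (b c : A) (r : Coalgebra.Repr k b (A × A)),
      ((1 : A) ⊗ₜ[k] c) * (antipode k (A := A)).lTensor A (comul (Λ * b))
        = ∑ i ∈ r.index, ((1 : A) ⊗ₜ[k] (c * antipode k (r.right i))) * casimir k Λ *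
            (r.left i ⊗ₜ[k] (1 : A)) := by
    intro b c r
    have : ∀ z : A ⊗[k] A, ∀ x y : A,
        ((1 : A) ⊗ₜ[k] c) * (antipode k (A := A)).lTensor A (z * (x ⊗ₜ y)) =
        ((1 : A) ⊗ₜ[k] (c * antipode k y)) * (antipode k (A := A)).lTensor A z *
            (x ⊗ₜ[k] (1 : A)) := by
      intro z x y
      induction z with
      | zero => simp
      | tmul p q => simp [antipode_mul_antidistrib, mul_assoc]
      | add p q hp hq => simp only [mul_add, map_add, add_mul, hp, hq]
    rw [Bialgebra.comul_mul, ← r.eq, Finset.mul_sum, map_sum, Finset.mul_sum]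
    exact Finset.sum_congr rfl fun i _ ↦ this _ _ _
  let r := Coalgebra.Repr.arbitrary k a
  let F : A ⊗[k] (A ⊗[k] A) →ₗ[k] A ⊗[k] A :=
    TensorProduct.lift (((LinearMap.mul k (A ⊗[k] A)).comp
      ((TensorProduct.mk k A A 1) ∘ₗ antipode k ∘ₗ LinearMap.mul' k A ∘ₗ
        (antipode k).lTensor A)).flip.comp
      ((LinearMap.mul k (A ⊗[k] A)) (casimir k Λ) ∘ₗ (TensorProduct.mk k A A).flip 1))
  have hF : ∀ p q s : A, F (p ⊗ₜ (q ⊗ₜ s)) =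
      ((1 : A) ⊗ₜ[k] (antipode k (antipode k s) * antipode k q)) * casimir k Λ *
        (p ⊗ₜ[k] (1 : A)) := fun p q s ↦ by
    simp [F, antipode_mul_antidistrib, mul_assoc]
  have e1 : F (comul.lTensor A (comul a)) = casimir k Λ * (a ⊗ₜ[k] (1 : A)) := by
    have : ∀ p b : A, F (p ⊗ₜ comul b) =
        casimir k Λ * ((counit (R := k) b • p) ⊗ₜ[k] (1 : A)) := by
      intro p b
      let s := Coalgebra.Repr.arbitrary k b
      rw [← s.eq, TensorProduct.tmul_sum, map_sum]
      simp_rw [hF, ← antipode_mul_antidistrib]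
      rw [← Finset.sum_mul, ← Finset.sum_mul, ← TensorProduct.tmul_sum, ← map_sum,
        sum_mul_antipode_eq_smul]
      simp [← Algebra.TensorProduct.one_def, ← TensorProduct.smul_tmul']
    rw [← r.eq, map_sum, map_sum]
    simp_rw [LinearMap.lTensor_tmul, this]
    rw [← Finset.mul_sum, ← TensorProduct.sum_tmul, sum_counit_right_smul_left]
  have e2 : F (comul.lTensor A (comul a)) =
      ((1 : A) ⊗ₜ[k] antipode k (antipode k a)) * casimir k Λ := by
    rw [← coassoc_apply, ← r.eq]
    simp only [map_sum, LinearMap.rTensor_tmul]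
    have : ∀ i, F (TensorProduct.assoc k A A A (comul (r.left i) ⊗ₜ r.right i)) =
        ((1 : A) ⊗ₜ[k] antipode k (antipode k (r.right i))) *
          counit (R := k) (r.left i) • casimir k Λ := by
      intro i
      let s := Coalgebra.Repr.arbitrary k (r.left i)
      rw [← s.eq, TensorProduct.sum_tmul, map_sum, map_sum]
      simp_rw [TensorProduct.assoc_tmul, hF]
      rw [← key, hΛ, map_smul, map_smul, casimir]
    simp_rw [this, mul_smul_comm, ← smul_mul_assoc, ← TensorProduct.tmul_smul, ← map_smul]
    rw [← Finset.sum_mul, ← TensorProduct.tmul_sum, ← map_sum, ← map_sum, sum_counit_smul]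
  rw [← e1, e2]

/-- The map `lam ⊗ id : A ⊗ T → k ⊗ T = T`, `a ⊗ t ↦ lam a • t`. -/
noncomputable def applyLeft (lam : A →ₗ[k] k) (T : Type*) [AddCommGroup T] [Module k T] :
    A ⊗[k] T →ₗ[k] T :=
  TensorProduct.lid k T ∘ₗ lam.rTensor T

@[simp]
theorem applyLeft_tmul (lam : A →ₗ[k] k) {T : Type*} [AddCommGroup T] [Module k T]
    (a : A) (t : T) : applyLeft lam T (a ⊗ₜ t) = lam a • t := by
  simp [applyLeft]

theorem applyLeft_mul_one_tmul (lam : A →ₗ[k] k) {T : Type*} [Ring T] [Algebra k T]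
    (z : A ⊗[k] T) (t : T) :
    applyLeft lam T (z * ((1 : A) ⊗ₜ t)) = applyLeft lam T z * t := by
  induction z with
  | zero => simp
  | tmul p q => simp
  | add p q hp hq => simp only [add_mul, map_add, hp, hq]

theorem applyLeft_one_tmul_mul (lam : A →ₗ[k] k) {T : Type*} [Ring T] [Algebra k T]
    (z : A ⊗[k] T) (t : T) :
    applyLeft lam T (((1 : A) ⊗ₜ t) * z) = t * applyLeft lam T z := by
  induction z with
  | zero => simp
  | tmul p q => simp
  | add p q hp hq => simp only [mul_add, map_add, hp, hq]

theorem applyLeft_lTensor (lam : A →ₗ[k] k) {T U : Type*} [AddCommGroup T] [Module k T]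
    [AddCommGroup U] [Module k U] (f : T →ₗ[k] U) (z : A ⊗[k] T) :
    applyLeft lam U (f.lTensor A z) = f (applyLeft lam T z) := by
  induction z with
  | zero => simp
  | tmul p q => simp
  | add p q hp hq => simp only [map_add, hp, hq]

theorem applyLeft_casimir {lam : A →ₗ[k] k}
    (hlam : ∀ a, applyLeft lam A (comul a) = lam a • 1) (Λ : A) :
    applyLeft lam A (casimir k Λ) = lam Λ • 1 := by
  rw [casimir, applyLeft_lTensor, hlam, map_smul, antipode_one]

end Frobenius

section Field

variable {k A : Type*} [Field k] [Ring A] [HopfAlgebra k A] [Module.Finite k A]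

/-- Normalized integrals pair nontrivially: write `∑ xᵢ ⊗ yᵢ` for `casimir k Λ`. The endomorphism
`a ↦ ∑ lam (xᵢ a) yᵢ` is `lam Λ • S²`, and its trace is `∑ lam (xᵢ yᵢ) = lam 1 * ε(Λ) = 1`. -/
theorem integral_apply_integral_ne_zero {lam : A →ₗ[k] k} {Λ : A} (h1 : lam 1 = 1)
    (hlam : ∀ a, applyLeft lam A (comul a) = lam a • 1) (hε : counit (R := k) Λ = 1)
    (hΛr : ∀ a : A, Λ * a = counit (R := k) a • Λ) : lam Λ ≠ 0 := by
  intro h0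
  let T : A ⊗[k] A →ₗ[k] (A →ₗ[k] A) :=
    TensorProduct.lift ((LinearMap.smulRightₗ (R := k) (M := A) (M₂ := A)) ∘ₗ
      (LinearMap.llcomp k A A k lam) ∘ₗ (LinearMap.mul k A))
  have hT : ∀ (z : A ⊗[k] A) (a : A), T z a = applyLeft lam A (z * (a ⊗ₜ[k] (1 : A))) := by
    intro z a
    induction z with
    | zero => simp
    | tmul p q => simp [T]
    | add p q hp hq => simp only [add_mul, map_add, LinearMap.add_apply, hp, hq]
  have htr : ∀ z : A ⊗[k] A, LinearMap.trace k A (T z) = lam (LinearMap.mul' k A z) := by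
    intro z
    induction z with
    | zero => simp
    | tmul p q =>
      have : T (p ⊗ₜ q) = (lam ∘ₗ LinearMap.mulLeft k p).smulRight q := by
        ext a; simp [T]
      rw [this, LinearMap.trace_smulRight]
      simp
    | add p q hp hq => simp only [map_add, hp, hq]
  have hz : T (casimir k Λ) = 0 := by
    ext a
    rw [hT, casimir_mul_tmul_one hΛr, applyLeft_one_tmul_mul, applyLeft_casimir hlam, h0]
    simp
  have := htr (casimir k Λ)
  rw [hz, mul'_casimir, hε] at this
  simp [h1] at this

/-- The Nakayama automorphism of a normalized integral is the square of the antipode. As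
`lam Λ ≠ 0`, the form `lam (x y)` is nondegenerate, so `lam (· a) = lam (x ·)` for some `x`;
contracting `casimir k Λ` with this functional gives both `lam Λ • x` and `lam Λ • S²(a)`. -/
theorem integral_mul_eq {lam : A →ₗ[k] k} {Λ : A} (h1 : lam 1 = 1)
    (hlam : ∀ a, applyLeft lam A (comul a) = lam a • 1) (hε : counit (R := k) Λ = 1)
    (hΛl : ∀ a : A, a * Λ = counit (R := k) a • Λ)
    (hΛr : ∀ a : A, Λ * a = counit (R := k) a • Λ) (z a : A) :
    lam (z * a) = lam (antipode k (antipode k a) * z) := by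
  have h0 := integral_apply_integral_ne_zero h1 hlam hε hΛr
  let θ : A →ₗ[k] (A →ₗ[k] k) := (LinearMap.llcomp k A A k lam) ∘ₗ (LinearMap.mul k A)
  have hθ : ∀ x y, θ x y = lam (x * y) := fun x y ↦ by simp [θ]
  have hψ : ∀ (f : A →ₗ[k] k) (x : A), (∀ y, f y = lam (x * y)) →
      applyLeft f A (casimir k Λ) = lam Λ • x := by
    intro f x hf
    have : ∀ z : A ⊗[k] A,
        applyLeft f A z = applyLeft lam A ((x ⊗ₜ[k] (1 : A)) * z) := by
      intro z
      induction z with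
      | zero => simp
      | tmul p q => simp [hf]
      | add p q hp hq => simp only [mul_add, map_add, hp, hq]
    rw [this, tmul_one_mul_casimir hΛl, applyLeft_mul_one_tmul, applyLeft_casimir hlam]
    simp
  have hinj : Function.Injective θ := by
    rw [injective_iff_map_eq_zero]
    intro x hx
    have := hψ 0 x (fun y ↦ by rw [← hθ, hx])
    have h2 : lam Λ • x = 0 := by rw [← this]; simp [applyLeft]
    exact (smul_eq_zero.1 h2).resolve_left h0
  have hsurj : Function.Surjective θ :=
    (LinearMap.injective_iff_surjective_of_finrank_eq_finrank
      (Subspace.dual_finrank_eq (K := k) (V := A)).symm).1 hinj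
  obtain ⟨x, hx⟩ := hsurj (lam ∘ₗ LinearMap.mulRight k a)
  have hx' : ∀ y, lam (y * a) = lam (x * y) := fun y ↦ by
    rw [← hθ x, hx]; simp
  have e1 := hψ (lam ∘ₗ LinearMap.mulRight k a) x (fun y ↦ by simpa using hx' y)
  have e2 : applyLeft (lam ∘ₗ LinearMap.mulRight k a) A (casimir k Λ) =
      lam Λ • antipode k (antipode k a) := by
    have : ∀ z : A ⊗[k] A, applyLeft (lam ∘ₗ LinearMap.mulRight k a) A z =
        applyLeft lam A (z * (a ⊗ₜ[k] (1 : A))) := by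
      intro z
      induction z with
      | zero => simp
      | tmul p q => simp
      | add p q hp hq => simp only [add_mul, map_add, hp, hq]
    rw [this, casimir_mul_tmul_one hΛr, applyLeft_one_tmul_mul, applyLeft_casimir hlam]
    simp
  have hxa : x = antipode k (antipode k a) := smul_right_injective A h0 (e1.symm.trans e2)
  rw [hx', hxa]

/-- Invariance of a normalized integral under the adjoint action:
`lam (S(a₍₁₎) z a₍₂₎) = ε(a) lam z`. -/
theorem integral_adjoint_invariant {lam : A →ₗ[k] k} {Λ : A} (h1 : lam 1 = 1)
    (hlam : ∀ a, applyLeft lam A (comul a) = lam a • 1) (hε : counit (R := k) Λ = 1)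
    (hΛl : ∀ a : A, a * Λ = counit (R := k) a • Λ)
    (hΛr : ∀ a : A, Λ * a = counit (R := k) a • Λ)
    {a : A} {ι : Type*} (r : Coalgebra.Repr k a ι) (z : A) :
    ∑ i ∈ r.index, lam (antipode k (r.left i) * z * r.right i) = counit (R := k) a * lam z := by
  have : ∀ i, lam (antipode k (r.left i) * z * r.right i) =
      lam (antipode k (r.left i * antipode k (r.right i)) * z) := fun i ↦ by
    rw [integral_mul_eq h1 hlam hε hΛl hΛr, ← mul_assoc, ← antipode_mul_antidistrib]
  simp_rw [this]
  rw [← map_sum, ← Finset.sum_mul, ← map_sum, sum_mul_antipode_eq_smul]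
  simp

end Field

/-! ### Cohomology of separable algebras -/

section Separable

variable {k A T : Type*} [CommRing k] [Ring A] [Algebra k A] [Ring T] [Algebra k T]

/-- Vanishing of the second Hochschild cohomology of a separable algebra: with
`e = ∑ xᵢ ⊗ yᵢ`, the cocycle `c` is the coboundary of `a ↦ ∑ c(a, xᵢ) ψ(yᵢ)`. -/
theorem exists_eq_hochschild_coboundary {e : A ⊗[k] A}
    (he : ∀ a : A, (a ⊗ₜ[k] (1 : A)) * e = e * ((1 : A) ⊗ₜ[k] a))
    (he1 : LinearMap.mul' k A e = 1) (ψ : A →ₐ[k] T) (c : A →ₗ[k] A →ₗ[k] T)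
    (hc : ∀ a b d, ψ a * c b d - c (a * b) d + c a (b * d) - c a b * ψ d = 0) :
    ∃ g : A →ₗ[k] T, ∀ a b, c a b = ψ a * g b - g (a * b) + g a * ψ b := by
  let N : A →ₗ[k] (A ⊗[k] A →ₗ[k] T) :=
    (LinearMap.llcomp k _ _ _ (LinearMap.mul' k T)) ∘ₗ
      ((TensorProduct.mapBilinear (RingHom.id k) A A T T).flip ψ.toLinearMap) ∘ₗ c
  have hN : ∀ a x y, N a (x ⊗ₜ y) = c a x * ψ y := fun a x y ↦ by simp [N]
  have h1 : ∀ a b z, ψ a * N b z - N (a * b) z + N a ((b ⊗ₜ[k] (1 : A)) * z)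
      - c a b * ψ (LinearMap.mul' k A z) = 0 := by
    intro a b z
    induction z with
    | zero => simp
    | tmul x y =>
      have := congrArg (· * ψ y) (hc a b x)
      simp only [sub_mul, add_mul, zero_mul, mul_assoc] at this
      simpa [hN, mul_assoc] using this
    | add x y hx hy =>
      have := congrArg₂ (· + ·) hx hy
      simp only [add_zero] at this
      simp only [mul_add, map_add]
      rw [← this]
      abel
  have h2 : ∀ a b z, N a (z * ((1 : A) ⊗ₜ[k] b)) = N a z * ψ b := by
    intro a b z
    induction z with
    | zero => simp
    | tmul x y => simp [hN, mul_assoc]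
    | add x y hx hy => simp only [add_mul, map_add, hx, hy]
  refine ⟨N.flip e, fun a b ↦ ?_⟩
  have := h1 a b e
  rw [he, h2, he1, map_one, mul_one, sub_eq_zero] at this
  simp [← this]

/-- Derivations of a separable algebra are inner: with `e = ∑ xᵢ ⊗ yᵢ`, the derivation `d` is the
commutator with `∑ d(xᵢ) ψ(yᵢ)`. -/
theorem exists_eq_commutator_of_leibniz {e : A ⊗[k] A}
    (he : ∀ a : A, (a ⊗ₜ[k] (1 : A)) * e = e * ((1 : A) ⊗ₜ[k] a))
    (he1 : LinearMap.mul' k A e = 1) (ψ : A →ₐ[k] T) (d : A →ₗ[k] T)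
    (hd : ∀ a b, d (a * b) = ψ a * d b + d a * ψ b) :
    ∃ v : T, ∀ a, d a = v * ψ a - ψ a * v := by
  let N : A ⊗[k] A →ₗ[k] T := LinearMap.mul' k T ∘ₗ TensorProduct.map d ψ.toLinearMap
  have h1 : ∀ a z, N ((a ⊗ₜ[k] (1 : A)) * z) = ψ a * N z + d a * ψ (LinearMap.mul' k A z) := by
    intro a z
    induction z with
    | zero => simp
    | tmul x y => simp [N, hd, add_mul, mul_assoc]
    | add x y hx hy => simp only [mul_add, map_add, hx, hy]; abel
  have h2 : ∀ a z, N (z * ((1 : A) ⊗ₜ[k] a)) = N z * ψ a := by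
    intro a z
    induction z with
    | zero => simp
    | tmul x y => simp [N, mul_assoc]
    | add x y hx hy => simp only [add_mul, map_add, hx, hy]
  refine ⟨N e, fun a ↦ ?_⟩
  have := h1 a e
  rw [he, h2, he1, map_one, mul_one] at this
  rw [this]; abel

end Separable

/-! ### Derivations and coderivations between Hopf algebras -/

section Integral

variable {k A B : Type*} [CommRing k] [Ring A] [HopfAlgebra k A] [Ring B] [HopfAlgebra k B]

/-- A bialgebra homomorphism of Hopf algebras commutes with the antipodes: `φ ∘ S` and `S ∘ φ` are
both convolution inverse to `φ`. -/
theorem BialgHom.map_antipode (φ : A →ₐc[k] B) (a : A) :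
    φ (antipode k a) = antipode k (φ a) := by
  have h : WithConv.toConv ((φ : A →ₗ[k] B) ∘ₗ antipode k) =
      WithConv.toConv (antipode k ∘ₗ (φ : A →ₗ[k] B)) := by
    apply left_inv_eq_right_inv (a := WithConv.toConv (φ : A →ₗ[k] B))
    · have := LinearMap.algHom_comp_convMul_distrib (φ : A →ₐ[k] B)
        (WithConv.toConv (antipode k)) (WithConv.toConv LinearMap.id)
      rw [LinearMap.antipode_mul_id] at this
      ext x
      have h2 := congrArg (fun f ↦ f x) this
      simp only [LinearMap.convMul_apply, LinearMap.convOne_apply] at h2 ⊢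
      simp only [LinearMap.comp_apply, LinearMap.convOne_apply] at h2
      exact h2.symm.trans (AlgHomClass.commutes φ _)
    · have := LinearMap.convMul_comp_coalgHom_distrib
        (WithConv.toConv LinearMap.id) (WithConv.toConv (antipode k)) (φ : A →ₗc[k] B)
      rw [LinearMap.id_mul_antipode] at this
      ext x
      have h2 := congrArg (fun f ↦ f x) this
      simp only [LinearMap.convMul_apply, LinearMap.convOne_apply] at h2 ⊢
      simp only [LinearMap.comp_apply, LinearMap.convOne_apply] at h2
      refine h2.symm.trans ?_
      exact congrArg _ (CoalgHomClass.counit_comp_apply φ x)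
  exact LinearMap.congr_fun (congrArg WithConv.ofConv h) a

/-- A functional `lam` on `B` with `lam 1 = 1` and `lam(b₍₁₎) b₍₂₎ = lam(b) 1` which is invariant
under the right adjoint action: `lam(S(b₍₁₎) z b₍₂₎) = ε(b) lam(z)`. -/
structure IsAdInvariantIntegral (lam : B →ₗ[k] k) : Prop where
  apply_one : lam 1 = 1
  applyLeft_comul : ∀ b, applyLeft lam B (comul b) = lam b • 1
  adjoint : ∀ (b z : B) (r : Coalgebra.Repr k b (B × B)),
    ∑ i ∈ r.index, lam (antipode k (r.left i) * z * r.right i) = counit (R := k) b * lam z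

/-- Contraction with an adjoint-invariant integral preserves centralizers: if `t ∈ B ⊗ T` commutes
with all `φ(a₍₁₎) ⊗ ψ(a₍₂₎)`, then `(lam ⊗ id) t` commutes with all `ψ(a)`. The reason is that
`1 ⊗ ψ(a) = (φ(S(a₍₁₎)) ⊗ 1) (φ(a₍₂₎) ⊗ ψ(a₍₃₎))`, so moving `ψ(a)` past `(lam ⊗ id) t` conjugates
the first factor of `t` by the adjoint action. -/
theorem IsAdInvariantIntegral.applyLeft_commute {lam : B →ₗ[k] k}
    (hlam : IsAdInvariantIntegral lam) (φ : A →ₐc[k] B) {T : Type*} [Ring T] [Algebra k T]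
    (ψ : A →ₐ[k] T) {t : B ⊗[k] T}
    (ht : ∀ a : A, t * TensorProduct.map (φ : A →ₗ[k] B) ψ.toLinearMap (comul a) =
      TensorProduct.map (φ : A →ₗ[k] B) ψ.toLinearMap (comul a) * t) (a : A) :
    applyLeft lam T t * ψ a = ψ a * applyLeft lam T t := by
  let Ψ : A ⊗[k] A →ₗ[k] B ⊗[k] T := TensorProduct.map (φ : A →ₗ[k] B) ψ.toLinearMap
  let J : A →ₗ[k] B ⊗[k] T := (TensorProduct.mk k B T).flip 1 ∘ₗ (φ : A →ₗ[k] B) ∘ₗ antipode k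
  let F : A ⊗[k] (A ⊗[k] A) →ₗ[k] T := applyLeft lam T ∘ₗ LinearMap.mul' k (B ⊗[k] T) ∘ₗ
    TensorProduct.map (LinearMap.mulRight k t ∘ₗ J) Ψ
  let G : A ⊗[k] (A ⊗[k] A) →ₗ[k] T := applyLeft lam T ∘ₗ LinearMap.mulRight k t ∘ₗ
    LinearMap.mul' k (B ⊗[k] T) ∘ₗ TensorProduct.map J Ψ
  have hF : ∀ p z, F (p ⊗ₜ z) = applyLeft lam T ((φ (antipode k p) ⊗ₜ 1) * t * Ψ z) :=
    fun p z ↦ by simp [F, J]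
  have hG : ∀ p z, G (p ⊗ₜ z) = applyLeft lam T ((φ (antipode k p) ⊗ₜ 1) * Ψ z * t) :=
    fun p z ↦ by simp [G, J]
  -- The commutation hypothesis on `t` makes `F` and `G` agree on `a₍₁₎ ⊗ a₍₂₎ ⊗ a₍₃₎`. By
  -- coassociativity, `F` also contracts `a₍₁₎` with `a₍₂₎` through the adjoint action on `t`, and
  -- `G` contracts them through the antipode.
  have hFG : F (comul.lTensor A (comul a)) = G (comul.lTensor A (comul a)) := by
    generalize comul (R := k) a = z
    induction z with
    | zero => simp
    | tmul x y =>
      rw [LinearMap.lTensor_tmul, hF, hG, mul_assoc, mul_assoc, ht y]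
    | add x y hx hy => simp only [map_add, hx, hy]
  have hadj : ∀ (b : A) (s : Coalgebra.Repr k b (A × A)) (w : B ⊗[k] T),
      ∑ j ∈ s.index, applyLeft lam T ((φ (antipode k (s.left j)) ⊗ₜ 1) * w *
        (φ (s.right j) ⊗ₜ 1)) = counit (R := k) b • applyLeft lam T w := by
    intro b s w
    induction w with
    | zero => simp
    | tmul x y =>
      let q : A ⊗[k] A →ₗ[k] k := lam ∘ₗ LinearMap.mul' k B ∘ₗ
        TensorProduct.map (LinearMap.mulRight k x ∘ₗ antipode k ∘ₗ (φ : A →ₗ[k] B))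
          (φ : A →ₗ[k] B)
      let q' : B ⊗[k] B →ₗ[k] k := lam ∘ₗ LinearMap.mul' k B ∘ₗ
        TensorProduct.map (LinearMap.mulRight k x ∘ₗ antipode k) .id
      have hq : ∀ z, q z = q' (TensorProduct.map (φ : A →ₗ[k] B) (φ : A →ₗ[k] B) z) := by
        intro z
        induction z with
        | zero => simp
        | tmul x y => simp [q, q']
        | add x y hx hy => simp only [map_add, hx, hy]
      have h1 : ∑ j ∈ s.index, lam (antipode k (φ (s.left j)) * x * φ (s.right j)) =
          counit (R := k) b * lam x := by
        have e1 : ∑ j ∈ s.index, lam (antipode k (φ (s.left j)) * x * φ (s.right j)) =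
            q (comul b) := by
          rw [← s.eq, map_sum]; simp [q]
        have e2 := hlam.adjoint (φ b) x (Coalgebra.Repr.arbitrary k (φ b))
        have e3 : q' (comul (φ b)) = counit (R := k) (φ b) * lam x := by
          rw [← e2, ← (Coalgebra.Repr.arbitrary k (φ b)).eq, map_sum]; simp [q']
        rw [e1, hq]
        have e4 := CoalgHomClass.map_comp_comul_apply φ b
        rw [e4, e3, CoalgHomClass.counit_comp_apply]
      simp only [Algebra.TensorProduct.tmul_mul_tmul, one_mul, mul_one, applyLeft_tmul,
        BialgHom.map_antipode]
      rw [← Finset.sum_smul, h1, mul_smul]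
    | add x y hx hy =>
      simp only [mul_add, add_mul, map_add, Finset.sum_add_distrib, hx, hy, smul_add]
  let r := Coalgebra.Repr.arbitrary k a
  have eF : F (comul.lTensor A (comul a)) = applyLeft lam T t * ψ a := by
    rw [← coassoc_apply, ← r.eq]
    simp only [map_sum, LinearMap.rTensor_tmul]
    have : ∀ i, F (TensorProduct.assoc k A A A (comul (r.left i) ⊗ₜ r.right i)) =
        counit (R := k) (r.left i) • (applyLeft lam T t * ψ (r.right i)) := by
      intro i
      let s := Coalgebra.Repr.arbitrary k (r.left i)
      rw [← s.eq, TensorProduct.sum_tmul, map_sum, map_sum]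
      have : ∀ j, F (TensorProduct.assoc k A A A ((s.left j ⊗ₜ s.right j) ⊗ₜ r.right i)) =
          applyLeft lam T ((φ (antipode k (s.left j)) ⊗ₜ 1) * t * (φ (s.right j) ⊗ₜ 1)) *
            ψ (r.right i) := by
        intro j
        rw [← applyLeft_mul_one_tmul, TensorProduct.assoc_tmul, hF, mul_assoc _ _ (1 ⊗ₜ _),
          Algebra.TensorProduct.tmul_mul_tmul]
        simp [Ψ]
      simp_rw [this]
      rw [← Finset.sum_mul, hadj, smul_mul_assoc]
    simp_rw [this]
    simp_rw [← mul_smul_comm, ← map_smul]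
    rw [← Finset.mul_sum, ← map_sum, sum_counit_smul]
  have eG : G (comul.lTensor A (comul a)) = ψ a * applyLeft lam T t := by
    rw [← coassoc_apply, ← r.eq]
    simp only [map_sum, LinearMap.rTensor_tmul]
    have : ∀ i, G (TensorProduct.assoc k A A A (comul (r.left i) ⊗ₜ r.right i)) =
        counit (R := k) (r.left i) • (ψ (r.right i) * applyLeft lam T t) := by
      intro i
      let s := Coalgebra.Repr.arbitrary k (r.left i)
      rw [← s.eq, TensorProduct.sum_tmul, map_sum, map_sum]
      have : ∀ j, G (TensorProduct.assoc k A A A ((s.left j ⊗ₜ s.right j) ⊗ₜ r.right i)) =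
          applyLeft lam T ((φ (antipode k (s.left j) * s.right j) ⊗ₜ ψ (r.right i)) * t) := by
        intro j
        rw [TensorProduct.assoc_tmul, hG]
        simp [Ψ]
      simp_rw [this]
      rw [← map_sum, ← Finset.sum_mul, ← TensorProduct.sum_tmul, ← map_sum,
        sum_antipode_mul_eq_smul, map_smul, map_one φ, ← applyLeft_one_tmul_mul,
        ← TensorProduct.smul_tmul', smul_mul_assoc, map_smul]
    simp_rw [this]
    simp_rw [← smul_mul_assoc, ← map_smul]
    rw [← Finset.sum_mul, ← map_sum, sum_counit_smul]
  rw [← eF, hFG, eG]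

/-- The inner derivation `a ↦ x ψ(a) - ψ(a) x` along an algebra homomorphism `ψ`. -/
noncomputable def innerDerivation {T : Type*} [Ring T] [Algebra k T] (ψ : A →ₐ[k] T) (x : T) :
    A →ₗ[k] T :=
  (LinearMap.mulLeft k x - LinearMap.mulRight k x) ∘ₗ ψ.toLinearMap

@[simp]
theorem innerDerivation_apply {T : Type*} [Ring T] [Algebra k T] (ψ : A →ₐ[k] T) (x : T) (a : A) :
    innerDerivation ψ x a = x * ψ a - ψ a * x := by
  simp [innerDerivation]

variable (k) in
/-- The differential `x ↦ 1 ⊗ x - Δ x + x ⊗ 1` of the cobar complex in degree one; its kernel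
consists of the primitive elements. -/
noncomputable def cobar₁ (x : B) : B ⊗[k] B := (1 : B) ⊗ₜ x - comul x + x ⊗ₜ (1 : B)

variable (k B) in
/-- The algebra homomorphism `id ⊗ Δ`. -/
noncomputable def comulRight : B ⊗[k] B →ₐ[k] B ⊗[k] (B ⊗[k] B) :=
  Algebra.TensorProduct.map (AlgHom.id k B) (Bialgebra.comulAlgHom k B)

variable (k B) in
/-- The algebra homomorphism `Δ ⊗ id`, followed by the associativity isomorphism. -/
noncomputable def comulLeft : B ⊗[k] B →ₐ[k] B ⊗[k] (B ⊗[k] B) :=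
  (Algebra.TensorProduct.assoc k k k B B B).toAlgHom.comp
    (Algebra.TensorProduct.map (Bialgebra.comulAlgHom k B) (AlgHom.id k B))

theorem comulRight_apply (z : B ⊗[k] B) : comulRight k B z = comul.lTensor B z := by
  induction z with
  | zero => simp
  | tmul p q => simp [comulRight]
  | add p q hp hq => simp only [map_add, hp, hq]

theorem comulLeft_apply (z : B ⊗[k] B) :
    comulLeft k B z = TensorProduct.assoc k B B B (comul.rTensor B z) := by
  induction z with
  | zero => simp
  | tmul p q =>
    simp only [comulLeft, LinearMap.rTensor_tmul]
    rfl
  | add p q hp hq => simp only [map_add, hp, hq]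

theorem one_tmul_commutator_map {T U : Type*} [Ring T] [Algebra k T] [Ring U] [Algebra k U]
    (φ : A →ₐ[k] U) (ψ : A →ₐ[k] T) (d : A →ₗ[k] T) (v : T)
    (hv : ∀ a, d a = v * ψ a - ψ a * v) (z : A ⊗[k] A) :
    ((1 : U) ⊗ₜ[k] v) * TensorProduct.map φ.toLinearMap ψ.toLinearMap z -
      TensorProduct.map φ.toLinearMap ψ.toLinearMap z * ((1 : U) ⊗ₜ[k] v) =
    TensorProduct.map φ.toLinearMap d z := by
  induction z with
  | zero => simp
  | tmul p q => simp [hv, TensorProduct.tmul_sub]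
  | add p q hp hq => simp only [map_add, mul_add, add_mul, ← hp, ← hq]; abel

theorem tmul_one_commutator_map {T U : Type*} [Ring T] [Algebra k T] [Ring U] [Algebra k U]
    (φ : A →ₐ[k] U) (ψ : A →ₐ[k] T) (d : A →ₗ[k] T) (v : T)
    (hv : ∀ a, d a = v * ψ a - ψ a * v) (z : A ⊗[k] A) :
    (v ⊗ₜ[k] (1 : U)) * TensorProduct.map ψ.toLinearMap φ.toLinearMap z -
      TensorProduct.map ψ.toLinearMap φ.toLinearMap z * (v ⊗ₜ[k] (1 : U)) =
    TensorProduct.map d φ.toLinearMap z := by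
  induction z with
  | zero => simp
  | tmul p q => simp [hv, TensorProduct.sub_tmul]
  | add p q hp hq => simp only [map_add, mul_add, add_mul, ← hp, ← hq]; abel

theorem map_comul_eq (φ : A →ₐc[k] B) (a : A) :
    TensorProduct.map (φ : A →ₐ[k] B).toLinearMap (φ : A →ₐ[k] B).toLinearMap (comul a) =
      comul (φ a) :=
  CoalgHomClass.map_comp_comul_apply φ a

theorem applyLeft_comulLeft {lam : B →ₗ[k] k} (hlam : IsAdInvariantIntegral lam) (v : B ⊗[k] B) :
    applyLeft lam (B ⊗[k] B) (comulLeft k B v) = (1 : B) ⊗ₜ applyLeft lam B v := by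
  rw [comulLeft_apply]
  have h : ∀ (w : B ⊗[k] B) (q : B), applyLeft lam (B ⊗[k] B)
      (TensorProduct.assoc k B B B (w ⊗ₜ q)) = applyLeft lam B w ⊗ₜ q := by
    intro w q
    induction w with
    | zero => simp
    | tmul x y => simp [TensorProduct.smul_tmul']
    | add x y hx hy => simp only [TensorProduct.add_tmul, map_add, hx, hy]
  induction v with
  | zero => simp
  | tmul p q =>
    rw [LinearMap.rTensor_tmul, h, hlam.applyLeft_comul]
    simp [TensorProduct.smul_tmul]
  | add p q hp hq => simp only [map_add, hp, hq, TensorProduct.tmul_add]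

theorem applyLeft_assoc_tmul_one (lam : B →ₗ[k] k) (v : B ⊗[k] B) :
    applyLeft lam (B ⊗[k] B) (TensorProduct.assoc k B B B (v ⊗ₜ 1)) =
      applyLeft lam B v ⊗ₜ (1 : B) := by
  induction v with
  | zero => simp
  | tmul x y => simp [TensorProduct.smul_tmul']
  | add x y hx hy => simp only [TensorProduct.add_tmul, map_add, hx, hy]

theorem map_leibniz_of_commutator {ψ : A →ₐ[k] B} {g : A →ₗ[k] B} {x : B}
    (hg : ∀ a, g a = x * ψ a - ψ a * x) (a b : A) :
    g (a * b) = ψ a * g b + g a * ψ b := by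
  simp only [hg, map_mul, mul_sub, sub_mul, mul_assoc]
  abel

/-- Infinitesimal rigidity: a map that is both a derivation and a coderivation along `φ` vanishes.
Being a derivation, it is `a ↦ [x, φ(a)]`. Being a coderivation means that `1 ⊗ x - Δ x + x ⊗ 1`
commutes with the image of `Δ ∘ φ`. Contraction with the integral turns this element into `x`, which
therefore commutes with the image of `φ`. -/
theorem eq_zero_of_leibniz_of_coleibniz {e : A ⊗[k] A}
    (he : ∀ a : A, (a ⊗ₜ[k] (1 : A)) * e = e * ((1 : A) ⊗ₜ[k] a))
    (he1 : LinearMap.mul' k A e = 1) {lam : B →ₗ[k] k} (hlam : IsAdInvariantIntegral lam)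
    (φ : A →ₐc[k] B) (g : A →ₗ[k] B)
    (hg : ∀ a b, g (a * b) = φ a * g b + g a * φ b)
    (hg' : ∀ a, comul (g a) = TensorProduct.map (φ : A →ₗ[k] B) g (comul a) +
      TensorProduct.map g (φ : A →ₗ[k] B) (comul a)) : g = 0 := by
  obtain ⟨x, hx⟩ := exists_eq_commutator_of_leibniz he he1 (φ : A →ₐ[k] B) g hg
  have ht : ∀ a : A, cobar₁ k x * TensorProduct.map (φ : A →ₐ[k] B).toLinearMap
      (φ : A →ₐ[k] B).toLinearMap (comul a) =
      TensorProduct.map (φ : A →ₐ[k] B).toLinearMap (φ : A →ₐ[k] B).toLinearMap (comul a) *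
        cobar₁ k x := by
    intro a
    rw [← sub_eq_zero]
    have h1 := one_tmul_commutator_map (φ : A →ₐ[k] B) (φ : A →ₐ[k] B) g x hx (comul a)
    have h2 := tmul_one_commutator_map (φ : A →ₐ[k] B) (φ : A →ₐ[k] B) g x hx (comul a)
    have h3 : comul x * comul (φ a) - comul (φ a) * comul x = comul (R := k) (g a) := by
      rw [hx, map_sub, Bialgebra.comul_mul, Bialgebra.comul_mul]; rfl
    rw [hg'] at h3
    rw [← map_comul_eq] at h3
    have h4 : ∀ P Q S Z : B ⊗[k] B, (P - Q + S) * Z - Z * (P - Q + S) =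
      (P * Z - Z * P) - (Q * Z - Z * Q) + (S * Z - Z * S) := by
      intros; simp only [mul_add, mul_sub, add_mul, sub_mul]; abel
    rw [cobar₁, h4, h1, h2, h3]
    change TensorProduct.map (φ : A →ₗ[k] B) g (comul a) -
      (TensorProduct.map (φ : A →ₗ[k] B) g (comul a) +
      TensorProduct.map g (φ : A →ₗ[k] B) (comul a)) +
      TensorProduct.map g (φ : A →ₗ[k] B) (comul a) = 0
    abel
  have h5 : applyLeft lam B (cobar₁ k x) = x := by
    simp [cobar₁, hlam.applyLeft_comul, hlam.apply_one]
  ext a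
  have := hlam.applyLeft_commute φ (φ : A →ₐ[k] B) ht a
  rw [h5] at this
  rw [hx, this, sub_self, LinearMap.zero_apply]

/-- Infinitesimal unobstructedness: a derivation `d` along `Δ ∘ φ` that satisfies the cocycle
condition expressing coassociativity is the failure of some derivation `g` along `φ` to be a
coderivation. Write `d(a) = [v, Δ(φ(a))]`. By the cocycle condition the cobar differential `t` of
`v` commutes with the image of `φ` in `B ⊗ B ⊗ B`. With `x = (lam ⊗ id) v`, contraction turns `t`
into `v - (1 ⊗ x - Δ x + x ⊗ 1)`, which hence commutes with the image of `Δ ∘ φ`. So `v` may be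
replaced by `1 ⊗ x - Δ x + x ⊗ 1`, and `g(a) = [x, φ(a)]`. -/
theorem exists_leibniz_eq_coboundary {e : A ⊗[k] A}
    (he : ∀ a : A, (a ⊗ₜ[k] (1 : A)) * e = e * ((1 : A) ⊗ₜ[k] a))
    (he1 : LinearMap.mul' k A e = 1) {lam : B →ₗ[k] k} (hlam : IsAdInvariantIntegral lam)
    (φ : A →ₐc[k] B) (d : A →ₗ[k] B ⊗[k] B)
    (hd : ∀ a b, d (a * b) = comul (φ a) * d b + d a * comul (φ b))
    (hd' : ∀ a, TensorProduct.map (φ : A →ₗ[k] B) d (comul a) + comul.lTensor B (d a) =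
      TensorProduct.assoc k B B B (TensorProduct.map d (φ : A →ₗ[k] B) (comul a)) +
      TensorProduct.assoc k B B B (comul.rTensor B (d a))) :
    ∃ g : A →ₗ[k] B, (∀ a b, g (a * b) = φ a * g b + g a * φ b) ∧
      ∀ a, d a = TensorProduct.map (φ : A →ₗ[k] B) g (comul a) +
        TensorProduct.map g (φ : A →ₗ[k] B) (comul a) - comul (g a) := by
  let φ' : A →ₐ[k] B := φ
  let ψ : A →ₐ[k] B ⊗[k] B := (Bialgebra.comulAlgHom k B).comp φ'
  have hψ : ∀ a, ψ a = comul (φ a) := fun a ↦ rfl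
  obtain ⟨v, hv⟩ := exists_eq_commutator_of_leibniz he he1 ψ d hd
  let α := Algebra.TensorProduct.assoc k k k B B B
  have hα : ∀ z, α z = TensorProduct.assoc k B B B z := fun z ↦ rfl
  -- The cobar differential of `v`. Its commutator with the image of `φ` is the cocycle condition.
  let t : B ⊗[k] (B ⊗[k] B) := (1 : B) ⊗ₜ v - comulLeft k B v + comulRight k B v - α (v ⊗ₜ 1)
  have ht : ∀ a : A, t * TensorProduct.map φ'.toLinearMap ψ.toLinearMap (comul a) =
      TensorProduct.map φ'.toLinearMap ψ.toLinearMap (comul a) * t := by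
    intro a
    rw [← sub_eq_zero]
    have h1 := one_tmul_commutator_map φ' ψ d v hv (comul a)
    have e2 : TensorProduct.map φ'.toLinearMap ψ.toLinearMap (comul a) =
        comulRight k B (comul (φ a)) := by
      rw [← map_comul_eq, comulRight_apply]
      generalize comul (R := k) a = z
      induction z with
      | zero => simp
      | tmul p q => simp; rfl
      | add p q hp hq => simp only [map_add, hp, hq]
    have e3 : TensorProduct.map φ'.toLinearMap ψ.toLinearMap (comul a) =
        comulLeft k B (comul (φ a)) := by
      rw [e2, comulRight_apply, comulLeft_apply, coassoc_apply]
    have e4 : TensorProduct.map φ'.toLinearMap ψ.toLinearMap (comul a) =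
        α (TensorProduct.map ψ.toLinearMap φ'.toLinearMap (comul a)) := by
      rw [e3, ← map_comul_eq, comulLeft_apply, hα]
      congr 1
      generalize comul (R := k) a = z
      induction z with
      | zero => simp
      | tmul p q => simp; rfl
      | add p q hp hq => simp only [map_add, hp, hq]
    have h2 : comulRight k B v * TensorProduct.map φ'.toLinearMap ψ.toLinearMap (comul a) -
        TensorProduct.map φ'.toLinearMap ψ.toLinearMap (comul a) * comulRight k B v =
        comul.lTensor B (d a) := by
      rw [e2, ← map_mul, ← map_mul, ← map_sub, ← hψ, ← hv, comulRight_apply]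
    have h3 : comulLeft k B v * TensorProduct.map φ'.toLinearMap ψ.toLinearMap (comul a) -
        TensorProduct.map φ'.toLinearMap ψ.toLinearMap (comul a) * comulLeft k B v =
        α (comul.rTensor B (d a)) := by
      rw [e3, ← map_mul, ← map_mul, ← map_sub, ← hψ, ← hv, comulLeft_apply, hα]
    have h4 : α (v ⊗ₜ 1) * TensorProduct.map φ'.toLinearMap ψ.toLinearMap (comul a) -
        TensorProduct.map φ'.toLinearMap ψ.toLinearMap (comul a) * α (v ⊗ₜ 1) =
        α (TensorProduct.map d φ'.toLinearMap (comul a)) := by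
      rw [e4, ← map_mul, ← map_mul, ← map_sub, tmul_one_commutator_map φ' ψ d v hv]
    have h5 : ∀ P Q S U Z : B ⊗[k] (B ⊗[k] B), (P - Q + S - U) * Z - Z * (P - Q + S - U) =
      (P * Z - Z * P) - (Q * Z - Z * Q) + (S * Z - Z * S) - (U * Z - Z * U) := by
      intros; simp only [mul_add, mul_sub, add_mul, sub_mul]; abel
    rw [h5, h1, h2, h3, h4]
    have := hd' a
    rw [← sub_eq_zero] at this
    rw [← this]
    change TensorProduct.map (φ : A →ₗ[k] B) d (comul a) -
      TensorProduct.assoc k B B B (comul.rTensor B (d a)) + comul.lTensor B (d a) -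
      TensorProduct.assoc k B B B (TensorProduct.map d (φ : A →ₗ[k] B) (comul a)) = _
    abel
  let x := applyLeft lam B v
  have h6 : applyLeft lam (B ⊗[k] B) t = v - cobar₁ k x := by
    simp only [t, map_add, map_sub, applyLeft_tmul, hlam.apply_one, one_smul,
      applyLeft_comulLeft hlam, hα, applyLeft_assoc_tmul_one, comulRight_apply,
      applyLeft_lTensor, cobar₁, x]
    abel
  refine ⟨innerDerivation φ' x,
    map_leibniz_of_commutator (innerDerivation_apply φ' x), fun a ↦ ?_⟩
  have h7 := hlam.applyLeft_commute φ ψ ht a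
  rw [h6] at h7
  have h8 : d a = cobar₁ k x * ψ a - ψ a * cobar₁ k x := by
    rw [hv, sub_eq_sub_iff_sub_eq_sub, ← sub_mul, ← mul_sub, h7]
  have h1 := one_tmul_commutator_map φ' φ' _ x (innerDerivation_apply φ' x) (comul a)
  have h2 := tmul_one_commutator_map φ' φ' _ x (innerDerivation_apply φ' x) (comul a)
  have h3 : comul x * comul (φ a) - comul (φ a) * comul x =
      comul (R := k) (innerDerivation φ' x a) := by
    rw [innerDerivation_apply, map_sub, Bialgebra.comul_mul, Bialgebra.comul_mul]; rfl
  have h4 : ∀ P Q S Z : B ⊗[k] B, (P - Q + S) * Z - Z * (P - Q + S) =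
      (P * Z - Z * P) + (S * Z - Z * S) - (Q * Z - Z * Q) := by
    intros; simp only [mul_add, mul_sub, add_mul, sub_mul]; abel
  rw [h8, cobar₁, h4, hψ, h3, ← map_comul_eq]
  exact congrArg₂ (· - ·) (congrArg₂ (· + ·) h1 h2) rfl

end Integral

/-! ### Integrals of semisimple and cosemisimple Hopf algebras -/

section Integrals

variable {k A : Type*} [Field k] [Ring A] [HopfAlgebra k A]

/-- The integral is the augmentation integral of the dual algebra with respect to evaluation at
`1`. -/
theorem IsCosemisimple.exists_integral [Module.Finite k A] (h : IsCosemisimple k A) :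
    ∃ lam : A →ₗ[k] k, lam 1 = 1 ∧ ∀ a, applyLeft lam A (comul a) = lam a • 1 := by
  have : IsSemisimpleRing (WithConv (A →ₗ[k] k)) := h
  let χ : WithConv (A →ₗ[k] k) →ₐ[k] k :=
    { toFun := fun f ↦ f 1
      map_one' := by simp
      map_mul' := fun f g ↦ by
        simp [LinearMap.convMul_apply, Algebra.TensorProduct.one_def]
      map_zero' := rfl
      map_add' := fun f g ↦ rfl
      commutes' := fun c ↦ by simp [LinearMap.convAlgebraMap_apply] }
  obtain ⟨e, he1, -, he⟩ := exists_augmentation_integral χ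
  refine ⟨e.ofConv, he1, fun a ↦ ?_⟩
  rw [← sub_eq_zero, ← Module.forall_dual_apply_eq_zero_iff k]
  intro f
  have h1 := congrArg (fun g ↦ g a) (he (WithConv.toConv f))
  have h2 : ∀ z : A ⊗[k] A, f (applyLeft e.ofConv A z) =
      LinearMap.mul' k k (TensorProduct.map e.ofConv f z) := by
    intro z
    induction z with
    | zero => simp
    | tmul p q => simp
    | add p q hp hq => simp only [map_add, hp, hq]
  rw [map_sub, h2, sub_eq_zero, map_smul]
  refine h1.trans ?_
  exact mul_comm _ _

theorem isAdInvariantIntegral_of_isSemisimpleRing [Module.Finite k A] [IsSemisimpleRing A]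
    {lam : A →ₗ[k] k} (h1 : lam 1 = 1) (h2 : ∀ a, applyLeft lam A (comul a) = lam a • 1) :
    IsAdInvariantIntegral lam := by
  obtain ⟨Λ, hΛ, hl, hr⟩ := exists_augmentation_integral (Bialgebra.counitAlgHom k A)
  exact ⟨h1, h2, fun b z r ↦ integral_adjoint_invariant h1 h2 hΛ hl hr r z⟩

theorem exists_separability_element [IsSemisimpleRing A] :
    ∃ e : A ⊗[k] A, (∀ a : A, (a ⊗ₜ[k] (1 : A)) * e = e * ((1 : A) ⊗ₜ[k] a)) ∧
      LinearMap.mul' k A e = 1 := by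
  obtain ⟨Λ, hΛ, hl, -⟩ := exists_augmentation_integral (Bialgebra.counitAlgHom k A)
  refine ⟨casimir k Λ, tmul_one_mul_casimir hl, ?_⟩
  rw [mul'_casimir]
  have : counit (R := k) Λ = 1 := hΛ
  rw [this, map_one]

end Integrals

/-! ### Divisibility and adic limits in modules -/

section Multiples

variable {R : Type*} [CommRing R]

/-- The submodule `c M` of multiples of `c` in an `R`-module `M`. -/
def multiples (c : R) (M : Type*) [AddCommGroup M] [Module R M] : Submodule R M :=
  LinearMap.range (LinearMap.lsmul R M c)

variable {M N : Type*} [AddCommGroup M] [Module R M] [AddCommGroup N] [Module R N]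

theorem smul_mem_multiples (c : R) (x : M) : c • x ∈ multiples c M := ⟨x, rfl⟩

theorem map_mem_multiples {c : R} (f : M →ₗ[R] N) {x : M} (hx : x ∈ multiples c M) :
    f x ∈ multiples c N := by
  obtain ⟨y, rfl⟩ := hx
  exact ⟨f y, by simp⟩

theorem multiples_mono {c d : R} (h : c ∣ d) : multiples d M ≤ multiples c M := by
  rintro _ ⟨y, rfl⟩
  obtain ⟨e, rfl⟩ := h
  exact ⟨e • y, by simp [smul_smul, mul_comm]⟩

theorem smul_mem_multiples_mul {c d : R} {x : M} (hx : x ∈ multiples d M) :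
    c • x ∈ multiples (c * d) M := by
  obtain ⟨y, rfl⟩ := hx
  exact ⟨y, by simp [mul_smul]⟩

theorem mem_multiples_of_smul_mem [IsDomain R] [Module.IsTorsionFree R M] {c d : R} (hc : c ≠ 0)
    {x : M} (hx : c • x ∈ multiples (c * d) M) : x ∈ multiples d M := by
  obtain ⟨y, hy⟩ := hx
  refine ⟨y, smul_right_injective M hc ?_⟩
  simpa [mul_smul] using hy

theorem exists_smul_eq_of_forall_mem_multiples [Module.Projective R M] {c : R} (f : M →ₗ[R] N)
    (hf : ∀ x, f x ∈ multiples c N) : ∃ g : M →ₗ[R] N, c • g = f := by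
  obtain ⟨g, hg⟩ := Module.projective_lifting_property (LinearMap.lsmul R N c).rangeRestrict
    (f.codRestrict _ hf) (LinearMap.surjective_rangeRestrict _)
  refine ⟨g, LinearMap.ext fun x ↦ ?_⟩
  have := congrArg Subtype.val (LinearMap.congr_fun hg x)
  exact this

end Multiples

section Adic

variable {R : Type*} [CommRing R] {t : R}
  {M : Type*} [AddCommGroup M] [Module R M] [Module.Free R M]

theorem mem_span_pow_smul_top {n : ℕ} {x : R} :
    x ∈ (Ideal.span {t} ^ n • ⊤ : Submodule R R) ↔ t ^ n ∣ x := by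
  rw [Ideal.span_singleton_pow, smul_eq_mul, Ideal.mul_top, Ideal.mem_span_singleton]

variable (t) in
theorem eq_zero_of_forall_mem_multiples_pow [IsHausdorff (Ideal.span {t}) R] {x : M}
    (hx : ∀ n, x ∈ multiples (t ^ n) M) :
    x = 0 := by
  let b := Module.Free.chooseBasis R M
  refine b.ext_elem fun i ↦ ?_
  rw [map_zero, Finsupp.zero_apply]
  refine IsHausdorff.haus (I := Ideal.span {t}) inferInstance _ fun n ↦ ?_
  rw [SModEq.zero, mem_span_pow_smul_top]
  obtain ⟨y, hy⟩ := hx n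
  exact ⟨b.repr y i, by rw [← hy]; simp⟩

variable (t) in
theorem exists_limit [IsPrecomplete (Ideal.span {t}) R] [Module.Finite R M]
    (F : ℕ → M) (hF : ∀ n, F (n + 1) - F n ∈ multiples (t ^ n) M) :
    ∃ L, ∀ n, L - F n ∈ multiples (t ^ n) M := by
  let b := Module.Free.chooseBasis R M
  have h1 : ∀ m n, m ≤ n → F n - F m ∈ multiples (t ^ m) M := by
    intro m n hmn
    induction n, hmn using Nat.le_induction with
    | base => simp
    | succ n hmn ih =>
      rw [← sub_add_sub_cancel _ (F n)]
      exact add_mem (multiples_mono (pow_dvd_pow t hmn) (hF n)) ih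
  have h2 : ∀ i, ∃ l : R, ∀ n, t ^ n ∣ l - b.repr (F n) i := by
    intro i
    obtain ⟨l, hl⟩ := IsPrecomplete.prec' (I := Ideal.span {t}) (M := R)
      (fun n ↦ b.repr (F n) i) (fun {m n} hmn ↦ by
        rw [SModEq.sub_mem, mem_span_pow_smul_top]
        obtain ⟨y, hy⟩ := h1 m n hmn
        rw [dvd_sub_comm]
        exact ⟨b.repr y i, by
          rw [← Finsupp.sub_apply, ← map_sub, ← hy]; simp⟩)
    refine ⟨l, fun n ↦ ?_⟩
    have := hl n
    rw [SModEq.sub_mem, mem_span_pow_smul_top] at this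
    rwa [dvd_sub_comm]
  choose l hl using h2
  refine ⟨b.equivFun.symm l, fun n ↦ ?_⟩
  choose y hy using fun i ↦ hl i n
  refine ⟨b.equivFun.symm y, ?_⟩
  apply b.equivFun.injective
  ext i
  rw [LinearMap.lsmul_apply, map_smul, map_sub, LinearEquiv.apply_symm_apply,
    LinearEquiv.apply_symm_apply, Pi.smul_apply, Pi.sub_apply, Module.Basis.equivFun_apply, hy,
    smul_eq_mul]

end Adic

/-! ### Reduction to the residue field -/

section Residue

/-- The field `k` is the quotient of `R` by the principal ideal generated by the nonzero element
`t`. -/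
structure IsResidueField (R k : Type*) [CommRing R] [Field k] [Algebra R k] (t : R) : Prop where
  ne_zero : t ≠ 0
  surjective : Function.Surjective (algebraMap R k)
  algebraMap_eq_zero_iff : ∀ x, algebraMap R k x = 0 ↔ t ∣ x

variable {R k : Type*} [CommRing R] [Field k] [Algebra R k]
  {M N : Type*} [AddCommGroup M] [Module R M] [AddCommGroup N] [Module R N]

variable (R k M) in
/-- The reduction map `M → k ⊗ M = M / t M`. -/
noncomputable def reduction : M →ₗ[R] k ⊗[R] M := TensorProduct.mk R k M 1

theorem reduction_apply (x : M) : reduction R k M x = 1 ⊗ₜ x := rfl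

namespace IsResidueField

variable {t : R} (hR : IsResidueField R k t)
include hR

theorem reduction_surjective : Function.Surjective (reduction R k M) := by
  intro z
  induction z with
  | zero => exact ⟨0, map_zero _⟩
  | tmul s m =>
    obtain ⟨r, rfl⟩ := hR.surjective s
    exact ⟨r • m, by
      rw [reduction_apply, ← TensorProduct.smul_tmul, Algebra.smul_def, mul_one]⟩
  | add p q hp hq =>
    obtain ⟨x, rfl⟩ := hp
    obtain ⟨y, rfl⟩ := hq
    exact ⟨x + y, map_add _ _ _⟩

theorem algebraMap_self : algebraMap R k t = 0 := (hR.algebraMap_eq_zero_iff t).2 dvd_rfl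

theorem reduction_eq_zero_iff {x : M} : reduction R k M x = 0 ↔ x ∈ multiples t M := by
  constructor
  · intro hx
    have hex : Function.Exact (LinearMap.lsmul R R t) (Algebra.linearMap R k) := by
      intro y
      rw [Algebra.linearMap_apply, hR.algebraMap_eq_zero_iff]
      exact ⟨fun ⟨z, hz⟩ ↦ ⟨z, hz.symm⟩, fun ⟨z, hz⟩ ↦ ⟨z, hz.symm⟩⟩
    have h2 := rTensor_exact M hex hR.surjective
    obtain ⟨z, hz⟩ := (h2 ((1 : R) ⊗ₜ x)).1 (by simpa [reduction_apply] using hx)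
    have h3 : ∀ z : R ⊗[R] M, TensorProduct.lid R M ((LinearMap.lsmul R R t).rTensor M z) =
        t • TensorProduct.lid R M z := by
      intro z
      induction z with
      | zero => simp
      | tmul p q => simp [mul_smul]
      | add p q hp hq => simp only [map_add, hp, hq, smul_add]
    refine ⟨TensorProduct.lid R M z, ?_⟩
    rw [LinearMap.lsmul_apply, ← h3, hz]
    simp
  · rintro ⟨y, rfl⟩
    rw [LinearMap.lsmul_apply, map_smul, reduction_apply, TensorProduct.smul_tmul',
      Algebra.smul_def, hR.algebraMap_self, zero_mul, TensorProduct.zero_tmul]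

theorem reduction_pow_smul {n : ℕ} (hn : 1 ≤ n) (x : M) : reduction R k M (t ^ n • x) = 0 :=
  hR.reduction_eq_zero_iff.2
    (multiples_mono (dvd_pow_self t (by omega)) (smul_mem_multiples (t ^ n) x))

theorem exists_lift [Module.Projective R M] (g : k ⊗[R] M →ₗ[k] k ⊗[R] N) :
    ∃ f : M →ₗ[R] N, ∀ x, reduction R k N (f x) = g (reduction R k M x) := by
  obtain ⟨f, hf⟩ := Module.projective_lifting_property (reduction R k N)
    (g.restrictScalars R ∘ₗ reduction R k M) hR.reduction_surjective
  exact ⟨f, fun x ↦ LinearMap.congr_fun hf x⟩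

end IsResidueField

section MapOver

variable {B C : Type*} [AddCommMonoid B] [Module R B] [Module k B] [IsScalarTower R k B]
  [AddCommMonoid C] [Module R C] [Module k C] [IsScalarTower R k C]

/-- The tensor product of two `R`-linear maps into `k`-modules, as a map to the tensor product over
`k`. -/
noncomputable def mapOver (f : M →ₗ[R] B) (g : N →ₗ[R] C) : M ⊗[R] N →ₗ[R] B ⊗[k] C :=
  TensorProduct.mapOfCompatibleSMul k R R B C ∘ₗ TensorProduct.map f g

end MapOver

variable (R k M N) in
/-- The reduction map of `M ⊗ N`, with values in the tensor product over `k` of the reductions of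
`M` and `N`. -/
noncomputable def reduction₂ : M ⊗[R] N →ₗ[R] (k ⊗[R] M) ⊗[k] (k ⊗[R] N) :=
  mapOver (reduction R k M) (reduction R k N)

@[simp]
theorem reduction₂_tmul (x : M) (y : N) :
    reduction₂ R k M N (x ⊗ₜ y) = reduction R k M x ⊗ₜ reduction R k N y := rfl

theorem reduction₂_eq (z : M ⊗[R] N) : reduction₂ R k M N z =
    TensorProduct.AlgebraTensorModule.distribBaseChange R k M N (reduction R k (M ⊗[R] N) z) := by
  induction z with
  | zero => simp
  | tmul p q => simp [reduction_apply]
  | add p q hp hq => simp only [map_add, hp, hq]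

theorem IsResidueField.reduction₂_eq_zero_iff {t : R} (hR : IsResidueField R k t)
    {z : M ⊗[R] N} : reduction₂ R k M N z = 0 ↔ z ∈ multiples t (M ⊗[R] N) := by
  rw [reduction₂_eq, LinearEquiv.map_eq_zero_iff, hR.reduction_eq_zero_iff]

variable (R k N) in
/-- The reduction map of `N ⊗ N ⊗ N`, with values in the triple tensor product over `k` of the
reduction of `N`. -/
noncomputable def reduction₃ :
    N ⊗[R] (N ⊗[R] N) →ₗ[R] (k ⊗[R] N) ⊗[k] ((k ⊗[R] N) ⊗[k] (k ⊗[R] N)) :=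
  mapOver (reduction R k N) (reduction₂ R k N N)

@[simp]
theorem reduction₃_tmul (x : N) (z : N ⊗[R] N) :
    reduction₃ R k N (x ⊗ₜ z) = reduction R k N x ⊗ₜ reduction₂ R k N N z := rfl

theorem reduction₃_assoc_tmul (z : N ⊗[R] N) (x : N) :
    reduction₃ R k N (TensorProduct.assoc R N N N (z ⊗ₜ x)) =
      TensorProduct.assoc k _ _ _ (reduction₂ R k N N z ⊗ₜ reduction R k N x) := by
  induction z with
  | zero => simp
  | tmul p q => simp
  | add p q hp hq => simp only [map_add, TensorProduct.add_tmul, hp, hq]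

section Map

variable {M' N' : Type*} [AddCommGroup M'] [Module R M'] [AddCommGroup N'] [Module R N']

theorem reduction₂_map {f : M →ₗ[R] M'} {g : N →ₗ[R] N'} {φ : k ⊗[R] M →ₗ[k] k ⊗[R] M'}
    {γ : k ⊗[R] N →ₗ[k] k ⊗[R] N'}
    (hf : ∀ x, reduction R k M' (f x) = φ (reduction R k M x))
    (hg : ∀ x, reduction R k N' (g x) = γ (reduction R k N x)) (z : M ⊗[R] N) :
    reduction₂ R k M' N' (TensorProduct.map f g z) =
      TensorProduct.map φ γ (reduction₂ R k M N z) := by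
  induction z with
  | zero => simp only [LinearMap.map_zero]
  | tmul p q => simp [hf, hg]
  | add p q hp hq => simp only [LinearMap.map_add, hp, hq]

variable {f : M →ₗ[R] N} {d : M →ₗ[R] N ⊗[R] N} {φ : k ⊗[R] M →ₗ[k] k ⊗[R] N}
  {δ : k ⊗[R] M →ₗ[k] (k ⊗[R] N) ⊗[k] (k ⊗[R] N)}

theorem reduction₃_map (hf : ∀ x, reduction R k N (f x) = φ (reduction R k M x))
    (hd : ∀ x, reduction₂ R k N N (d x) = δ (reduction R k M x)) (z : M ⊗[R] M) :
    reduction₃ R k N (TensorProduct.map f d z) =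
      TensorProduct.map φ δ (reduction₂ R k M M z) := by
  induction z with
  | zero => simp only [LinearMap.map_zero]
  | tmul p q =>
    rw [TensorProduct.map_tmul, reduction₃_tmul, reduction₂_tmul, TensorProduct.map_tmul, hf, hd]
  | add p q hp hq => simp only [LinearMap.map_add, hp, hq]

theorem reduction₃_assoc_map (hf : ∀ x, reduction R k N (f x) = φ (reduction R k M x))
    (hd : ∀ x, reduction₂ R k N N (d x) = δ (reduction R k M x)) (z : M ⊗[R] M) :
    reduction₃ R k N (TensorProduct.assoc R N N N (TensorProduct.map d f z)) =
      TensorProduct.assoc k _ _ _ (TensorProduct.map δ φ (reduction₂ R k M M z)) := by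
  induction z with
  | zero => simp only [LinearMap.map_zero, LinearEquiv.map_zero]
  | tmul p q =>
    rw [TensorProduct.map_tmul, reduction₃_assoc_tmul, reduction₂_tmul, TensorProduct.map_tmul,
      hf, hd]
  | add p q hp hq => simp only [LinearMap.map_add, LinearEquiv.map_add, hp, hq]

end Map

section Ring

variable {H K : Type*} [Ring H] [Algebra R H] [Ring K] [Algebra R K]

theorem reduction_mul (x y : H) :
    reduction R k H (x * y) = reduction R k H x * reduction R k H y := by
  simp [reduction_apply]

theorem reduction_one : reduction R k H 1 = 1 := rfl

theorem reduction₂_mul (x y : H ⊗[R] K) :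
    reduction₂ R k H K (x * y) = reduction₂ R k H K x * reduction₂ R k H K y := by
  induction x with
  | zero => simp
  | add p q hp hq => simp only [map_add, add_mul, hp, hq]
  | tmul p q =>
    induction y with
    | zero => simp
    | add p q hp hq => simp only [map_add, mul_add, hp, hq]
    | tmul r s => simp [reduction_mul]

end Ring

section Coalgebra

variable {H : Type*} [Ring H] [HopfAlgebra R H]

theorem comul_reduction (x : H) :
    comul (R := k) (reduction R k H x) = reduction₂ R k H H (comul x) := by
  rw [reduction_apply, TensorProduct.comul_tmul]
  generalize comul (R := R) x = z
  induction z with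
  | zero => simp
  | tmul p q => simp [reduction_apply]
  | add p q hp hq => simp only [map_add, TensorProduct.tmul_add, hp, hq]

theorem counit_reduction (x : H) :
    counit (R := k) (reduction R k H x) = algebraMap R k (counit x) := by
  rw [reduction_apply, TensorProduct.counit_tmul]
  simp [Algebra.smul_def]

theorem reduction₃_lTensor_comul (w : H ⊗[R] H) :
    reduction₃ R k H (comul.lTensor H w) = comul.lTensor _ (reduction₂ R k H H w) := by
  induction w with
  | zero => simp only [LinearMap.map_zero]
  | tmul p q =>
    rw [LinearMap.lTensor_tmul, reduction₃_tmul, reduction₂_tmul, LinearMap.lTensor_tmul,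
      comul_reduction]
  | add p q hp hq => simp only [LinearMap.map_add, hp, hq]

theorem reduction₃_assoc_rTensor_comul (w : H ⊗[R] H) :
    reduction₃ R k H (TensorProduct.assoc R H H H (comul.rTensor H w)) =
      TensorProduct.assoc k _ _ _ (comul.rTensor _ (reduction₂ R k H H w)) := by
  induction w with
  | zero => simp only [LinearMap.map_zero, LinearEquiv.map_zero]
  | tmul p q =>
    rw [LinearMap.rTensor_tmul, reduction₃_assoc_tmul, reduction₂_tmul, LinearMap.rTensor_tmul,
      comul_reduction]
  | add p q hp hq => simp only [LinearMap.map_add, LinearEquiv.map_add, hp, hq]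

end Coalgebra

end Residue

/-! ### Correction of approximate homomorphisms -/

section Lifting

variable {R k : Type*} [CommRing R] [Field k] [Algebra R k] {t : R}
  {H K : Type*} [Ring H] [HopfAlgebra R H] [Ring K] [HopfAlgebra R K]

/-- The linear map `f` is multiplicative modulo `c`. -/
def MulModulo (c : R) (f : H →ₗ[R] K) : Prop :=
  ∀ a b, f (a * b) - f a * f b ∈ multiples c K

/-- The linear map `f` is comultiplicative modulo `c`. -/
def ComulModulo (c : R) (f : H →ₗ[R] K) : Prop :=
  ∀ a, comul (f a) - TensorProduct.map f f (comul a) ∈ multiples c (K ⊗[R] K)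

theorem map_mul_sub_mem_multiples {c : R} {f : H →ₗ[R] K} (hf : MulModulo c f)
    (z w : H ⊗[R] H) :
    TensorProduct.map f f (z * w) - TensorProduct.map f f z * TensorProduct.map f f w ∈
      multiples c (K ⊗[R] K) := by
  induction z with
  | zero => simp
  | add p q hp hq =>
    simp only [map_add, add_mul]
    rw [add_sub_add_comm]
    exact add_mem hp hq
  | tmul x y =>
    induction w with
    | zero => simp
    | add p q hp hq =>
      simp only [map_add, mul_add]
      rw [add_sub_add_comm]
      exact add_mem hp hq
    | tmul x' y' =>
      obtain ⟨u, hu⟩ := hf x x'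
      obtain ⟨v, hv⟩ := hf y y'
      refine ⟨u ⊗ₜ f (y * y') + (f x * f x') ⊗ₜ v, ?_⟩
      rw [LinearMap.lsmul_apply] at hu hv ⊢
      simp only [Algebra.TensorProduct.tmul_mul_tmul, TensorProduct.map_tmul]
      rw [smul_add, TensorProduct.smul_tmul', ← TensorProduct.tmul_smul, hu, hv,
        TensorProduct.sub_tmul, TensorProduct.tmul_sub]
      abel

/-- A lift of `φ` that is multiplicative modulo `t ^ n` can be corrected by a multiple of `t ^ n` so
as to be multiplicative modulo `t ^ (n + 1)`: its failure to be multiplicative, divided by `t ^ n`,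
reduces to a Hochschild 2-cocycle. -/
theorem exists_mulModulo_succ [IsDomain R] [Module.Free R H] [Module.Free R K]
    (hR : IsResidueField R k t)
    {e : (k ⊗[R] H) ⊗[k] (k ⊗[R] H)}
    (he : ∀ a : k ⊗[R] H, (a ⊗ₜ[k] (1 : k ⊗[R] H)) * e = e * ((1 : k ⊗[R] H) ⊗ₜ[k] a))
    (he1 : LinearMap.mul' k (k ⊗[R] H) e = 1) (φ : k ⊗[R] H →ₐc[k] k ⊗[R] K)
    {n : ℕ} (hn : 1 ≤ n) (f : H →ₗ[R] K)
    (hf : ∀ a, reduction R k K (f a) = φ (reduction R k H a)) (hmul : MulModulo (t ^ n) f) :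
    ∃ g : H →ₗ[R] K, MulModulo (t ^ (n + 1)) (f + t ^ n • g) := by
  have htn : t ^ n ≠ 0 := pow_ne_zero n hR.ne_zero
  obtain ⟨C, hC⟩ : ∃ C : H ⊗[R] H →ₗ[R] K, t ^ n • C =
      f ∘ₗ LinearMap.mul' R H - LinearMap.mul' R K ∘ₗ TensorProduct.map f f := by
    refine exists_smul_eq_of_forall_mem_multiples _ fun z ↦ ?_
    induction z with
    | zero => simp
    | tmul x y => simpa using hmul x y
    | add p q hp hq => rw [map_add]; exact add_mem hp hq
  have hC' : ∀ a b, t ^ n • C (a ⊗ₜ b) = f (a * b) - f a * f b := fun a b ↦ by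
    simpa using LinearMap.congr_fun hC (a ⊗ₜ b)
  have hcoc : ∀ a b d, f a * C (b ⊗ₜ d) - C ((a * b) ⊗ₜ d) + C (a ⊗ₜ (b * d)) -
      C (a ⊗ₜ b) * f d = 0 := by
    intro a b d
    refine smul_right_injective K htn ?_
    have hl : ∀ x a b, t ^ n • (x * C (a ⊗ₜ b)) = x * (f (a * b) - f a * f b) :=
      fun x a b ↦ by rw [← mul_smul_comm, hC']
    have hr : ∀ x a b, t ^ n • (C (a ⊗ₜ b) * x) = (f (a * b) - f a * f b) * x :=
      fun x a b ↦ by rw [← smul_mul_assoc, hC']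
    simp only [smul_sub, smul_add, hl, hr, smul_zero, hC', mul_sub, sub_mul, mul_assoc]
    abel
  let c : k ⊗[R] H →ₗ[k] k ⊗[R] H →ₗ[k] k ⊗[R] K := TensorProduct.curry
    ((C.baseChange k) ∘ₗ
      (TensorProduct.AlgebraTensorModule.distribBaseChange R k H H).symm.toLinearMap)
  have hc : ∀ a b, c (reduction R k H a) (reduction R k H b) = reduction R k K (C (a ⊗ₜ b)) :=
    fun a b ↦ by simp [c, reduction_apply]
  obtain ⟨g, hg⟩ := exists_eq_hochschild_coboundary he he1 (φ : k ⊗[R] H →ₐ[k] k ⊗[R] K) c (by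
    intro a b d
    obtain ⟨a, rfl⟩ := hR.reduction_surjective a
    obtain ⟨b, rfl⟩ := hR.reduction_surjective b
    obtain ⟨d, rfl⟩ := hR.reduction_surjective d
    have := congrArg (reduction R k K) (hcoc a b d)
    rw [map_sub, map_add, map_sub, reduction_mul, reduction_mul, hf, hf, map_zero] at this
    rw [← reduction_mul, ← reduction_mul, hc, hc, hc, hc]
    exact this)
  obtain ⟨G, hG⟩ := hR.exists_lift g
  refine ⟨G, fun a b ↦ ?_⟩
  have key : (f + t ^ n • G) (a * b) - (f + t ^ n • G) a * (f + t ^ n • G) b =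
      t ^ n • (C (a ⊗ₜ b) + G (a * b) - f a * G b - G a * f b - t ^ n • (G a * G b)) := by
    simp only [LinearMap.add_apply, LinearMap.smul_apply, smul_sub, smul_add, hC', add_mul,
      mul_add, mul_smul_comm, smul_mul_assoc]
    abel
  rw [key, pow_succ]
  refine smul_mem_multiples_mul (hR.reduction_eq_zero_iff (k := k).1 ?_)
  have : c _ _ = φ _ * g _ - _ + _ * φ _ := hg (reduction R k H a) (reduction R k H b)
  rw [hc, ← reduction_mul, ← hG, ← hG, ← hG] at this
  rw [map_sub, map_sub, map_sub, map_add, hR.reduction_pow_smul hn, reduction_mul, reduction_mul,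
    hf, hf, this]
  abel

/-- The failure of a linear map `f` to be comultiplicative, divided by any `c`, satisfies the
cocycle condition expressing coassociativity, exactly and not only modulo `c`. -/
theorem comulModulo_coassoc [IsDomain R] [Module.Free R K] {c : R} (hc : c ≠ 0) {f : H →ₗ[R] K}
    {d : H →ₗ[R] K ⊗[R] K}
    (hd : ∀ a, c • d a = comul (f a) - TensorProduct.map f f (comul a)) (a : H) :
    TensorProduct.map f d (comul a) + comul.lTensor K (d a) =
      TensorProduct.assoc R K K K (TensorProduct.map d f (comul a)) +
      TensorProduct.assoc R K K K (comul.rTensor K (d a)) := by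
  refine smul_right_injective _ hc ?_
  have h1 : ∀ z : H ⊗[R] H, c • TensorProduct.map f d z =
      comul.lTensor K (TensorProduct.map f f z) -
        TensorProduct.map f (TensorProduct.map f f) (comul.lTensor H z) := by
    intro z
    induction z with
    | zero => simp
    | tmul p q =>
      simp only [TensorProduct.map_tmul, ← TensorProduct.tmul_smul, hd, LinearMap.lTensor_tmul,
        TensorProduct.tmul_sub]
    | add p q hp hq => simp only [map_add, smul_add, hp, hq]; abel
  have h2 : ∀ z : H ⊗[R] H, c • TensorProduct.map d f z =
      comul.rTensor K (TensorProduct.map f f z) -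
        TensorProduct.map (TensorProduct.map f f) f (comul.rTensor H z) := by
    intro z
    induction z with
    | zero => simp
    | tmul p q =>
      simp only [TensorProduct.map_tmul, TensorProduct.smul_tmul', hd, LinearMap.rTensor_tmul,
        TensorProduct.sub_tmul]
    | add p q hp hq => simp only [map_add, smul_add, hp, hq]; abel
  have h3 : TensorProduct.assoc R K K K (TensorProduct.map (TensorProduct.map f f) f
      (comul.rTensor H (comul a))) =
      TensorProduct.map f (TensorProduct.map f f) (comul.lTensor H (comul a)) := by
    rw [← coassoc_apply, TensorProduct.map_map_assoc]
  have h4 : c • comul.lTensor K (d a) = comul.lTensor K (c • d a) := (map_smul _ _ _).symm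
  have h5 : c • TensorProduct.assoc R K K K (comul.rTensor K (d a)) =
      TensorProduct.assoc R K K K (comul.rTensor K (c • d a)) := by
    rw [map_smul, map_smul]
  have h6 : c • TensorProduct.assoc R K K K (TensorProduct.map d f (comul a)) =
      TensorProduct.assoc R K K K (c • TensorProduct.map d f (comul a)) := (map_smul _ _ _).symm
  change c • (_ + _) = c • (_ + _)
  rw [smul_add, smul_add, h1, h4, h5, h6, h2, hd]
  simp only [map_sub, coassoc_apply, h3]
  abel

/-- If a lift of `φ` is multiplicative modulo `t ^ (n + 1)` and comultiplicative modulo `t ^ n`,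
then its failure to be comultiplicative, divided by `t ^ n`, reduces to a derivation satisfying the
hypotheses of `exists_leibniz_eq_coboundary`. As the correction provided there is a derivation, it
does not disturb multiplicativity. -/
theorem exists_comulModulo_succ [IsDomain R] [Module.Free R H] [Module.Free R K]
    (hR : IsResidueField R k t)
    {e : (k ⊗[R] H) ⊗[k] (k ⊗[R] H)}
    (he : ∀ a : k ⊗[R] H, (a ⊗ₜ[k] (1 : k ⊗[R] H)) * e = e * ((1 : k ⊗[R] H) ⊗ₜ[k] a))
    (he1 : LinearMap.mul' k (k ⊗[R] H) e = 1)
    {lam : k ⊗[R] K →ₗ[k] k} (hlam : IsAdInvariantIntegral lam)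
    (φ : k ⊗[R] H →ₐc[k] k ⊗[R] K)
    {n : ℕ} (hn : 1 ≤ n) (f : H →ₗ[R] K)
    (hf : ∀ a, reduction R k K (f a) = φ (reduction R k H a))
    (hmul : MulModulo (t ^ (n + 1)) f) (hcomul : ComulModulo (t ^ n) f) :
    ∃ g : H →ₗ[R] K, MulModulo (t ^ (n + 1)) (f + t ^ n • g) ∧
      ComulModulo (t ^ (n + 1)) (f + t ^ n • g) := by
  have htn : t ^ n ≠ 0 := pow_ne_zero n hR.ne_zero
  obtain ⟨D, hD⟩ := exists_smul_eq_of_forall_mem_multiples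
    (comul ∘ₗ f - TensorProduct.map f f ∘ₗ comul) hcomul
  have hD' : ∀ a, t ^ n • D a = comul (f a) - TensorProduct.map f f (comul a) := fun a ↦
    LinearMap.congr_fun hD a
  let d : k ⊗[R] H →ₗ[k] (k ⊗[R] K) ⊗[k] (k ⊗[R] K) :=
    (TensorProduct.AlgebraTensorModule.distribBaseChange R k K K).toLinearMap ∘ₗ D.baseChange k
  have hd : ∀ a, d (reduction R k H a) = reduction₂ R k K K (D a) := fun a ↦ by
    rw [reduction₂_eq]; simp [d, reduction_apply]
  have hfc : ∀ z, reduction₂ R k K K (TensorProduct.map f f z) =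
      TensorProduct.map (φ : k ⊗[R] H →ₗ[k] k ⊗[R] K) (φ : k ⊗[R] H →ₗ[k] k ⊗[R] K)
        (reduction₂ R k H H z) := reduction₂_map hf hf
  have hleib : ∀ a b, d (a * b) = comul (φ a) * d b + d a * comul (φ b) := by
    intro a b
    obtain ⟨a, rfl⟩ := hR.reduction_surjective a
    obtain ⟨b, rfl⟩ := hR.reduction_surjective b
    have h1 : t ^ n • (D (a * b) - comul (f a) * D b - D a * TensorProduct.map f f (comul b)) ∈
        multiples (t ^ n * t) (K ⊗[R] K) := by
      rw [← pow_succ]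
      have h2 := map_mem_multiples (comul (R := R)) (hmul a b)
      have h3 := map_mul_sub_mem_multiples hmul (comul a) (comul b)
      convert sub_mem h2 h3 using 1
      rw [smul_sub, smul_sub, ← mul_smul_comm, ← smul_mul_assoc, hD', hD', hD']
      simp only [map_sub, Bialgebra.comul_mul, mul_sub, sub_mul]
      abel
    have h4 := hR.reduction₂_eq_zero_iff.2 (mem_multiples_of_smul_mem htn h1)
    rw [map_sub, map_sub, reduction₂_mul, reduction₂_mul, ← comul_reduction, hfc,
      ← comul_reduction, hf, sub_sub, sub_eq_zero] at h4
    rw [← reduction_mul, hd, hd, hd, h4]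
    congr 2
    exact CoalgHomClass.map_comp_comul_apply φ _
  have hcoass : ∀ a, TensorProduct.map (φ : k ⊗[R] H →ₗ[k] k ⊗[R] K) d (comul a) +
      comul.lTensor _ (d a) =
      TensorProduct.assoc k _ _ _ (TensorProduct.map d (φ : k ⊗[R] H →ₗ[k] k ⊗[R] K) (comul a)) +
      TensorProduct.assoc k _ _ _ (comul.rTensor _ (d a)) := by
    intro a
    obtain ⟨a, rfl⟩ := hR.reduction_surjective a
    have h0 := congrArg (reduction₃ R k K) (comulModulo_coassoc htn hD' a)
    rw [LinearMap.map_add, LinearMap.map_add, reduction₃_map hf (fun a ↦ (hd a).symm),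
      reduction₃_lTensor_comul, reduction₃_assoc_map hf (fun a ↦ (hd a).symm),
      reduction₃_assoc_rTensor_comul, ← hd, ← comul_reduction] at h0
    exact h0
  obtain ⟨g, hg, hg'⟩ := exists_leibniz_eq_coboundary he he1 hlam φ d hleib hcoass
  obtain ⟨G, hG⟩ := hR.exists_lift g
  refine ⟨G, fun a b ↦ ?_, fun a ↦ ?_⟩
  · have key : (f + t ^ n • G) (a * b) - (f + t ^ n • G) a * (f + t ^ n • G) b =
        (f (a * b) - f a * f b) +
        t ^ n • (G (a * b) - (f a * G b + G a * f b) - t ^ n • (G a * G b)) := by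
      simp only [LinearMap.add_apply, LinearMap.smul_apply, smul_sub, smul_add, add_mul,
        mul_add, mul_smul_comm, smul_mul_assoc]
      abel
    rw [key]
    refine add_mem (hmul a b) ?_
    rw [pow_succ]
    refine smul_mem_multiples_mul (hR.reduction_eq_zero_iff (k := k).1 ?_)
    have := hg (reduction R k H a) (reduction R k H b)
    rw [← reduction_mul, ← hG, ← hG, ← hG] at this
    rw [map_sub, map_sub, map_add, hR.reduction_pow_smul hn, reduction_mul, reduction_mul,
      hf, hf, this]
    simp
  · have h1 : ∀ z, TensorProduct.map (f + t ^ n • G) (f + t ^ n • G) z =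
        TensorProduct.map f f z + t ^ n • (TensorProduct.map f G z + TensorProduct.map G f z +
          t ^ n • TensorProduct.map G G z) := by
      intro z
      simp only [TensorProduct.map_add_left, TensorProduct.map_add_right,
        TensorProduct.map_smul_left, TensorProduct.map_smul_right, LinearMap.add_apply,
        LinearMap.smul_apply, smul_add]
      abel
    have key : comul ((f + t ^ n • G) a) -
        TensorProduct.map (f + t ^ n • G) (f + t ^ n • G) (comul a) =
        t ^ n • (D a + comul (G a) - TensorProduct.map f G (comul a) -
          TensorProduct.map G f (comul a) - t ^ n • TensorProduct.map G G (comul a)) := by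
      rw [h1]
      simp only [smul_sub, smul_add, hD', LinearMap.add_apply, LinearMap.smul_apply, map_add,
        map_smul]
      abel
    rw [key, pow_succ]
    refine smul_mem_multiples_mul (hR.reduction₂_eq_zero_iff (k := k).1 ?_)
    have h2 : ∀ z, reduction₂ R k K K (TensorProduct.map f G z) =
        TensorProduct.map (φ : k ⊗[R] H →ₗ[k] k ⊗[R] K) g (reduction₂ R k H H z) :=
      reduction₂_map hf hG
    have h3 : ∀ z, reduction₂ R k K K (TensorProduct.map G f z) =
        TensorProduct.map g (φ : k ⊗[R] H →ₗ[k] k ⊗[R] K) (reduction₂ R k H H z) :=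
      reduction₂_map hG hf
    have h4 : reduction₂ R k K K (t ^ n • TensorProduct.map G G (comul a)) = 0 :=
      hR.reduction₂_eq_zero_iff.2
        (multiples_mono (dvd_pow_self t (by omega)) (smul_mem_multiples (t ^ n) _))
    have h5 := hg' (reduction R k H a)
    rw [hd, comul_reduction, ← hG, comul_reduction, ← h2, ← h3] at h5
    rw [map_sub, map_sub, map_sub, map_add, h4, h5]
    abel

end Lifting

/-! ### Existence and uniqueness of lifts over an adically complete domain -/

section Main

variable {R k : Type*} [CommRing R] [Field k] [Algebra R k] {t : R}
  {H K : Type*} [Ring H] [HopfAlgebra R H] [Ring K] [HopfAlgebra R K]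

theorem MulModulo.of_sub_mem {c : R} {f g : H →ₗ[R] K} (hf : MulModulo c f)
    (h : g - f ∈ multiples c (H →ₗ[R] K)) : MulModulo c g := by
  obtain ⟨u, hu⟩ := h
  obtain rfl : g = f + c • u := sub_eq_iff_eq_add'.1 hu.symm
  intro a b
  have : (f + c • u) (a * b) - (f + c • u) a * (f + c • u) b = (f (a * b) - f a * f b) +
      c • (u (a * b) - f a * u b - u a * f b - c • (u a * u b)) := by
    simp only [LinearMap.add_apply, LinearMap.smul_apply, smul_sub, smul_add, add_mul, mul_add,
      mul_smul_comm, smul_mul_assoc]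
    abel
  rw [this]
  exact add_mem (hf a b) (smul_mem_multiples _ _)

theorem ComulModulo.of_sub_mem {c : R} {f g : H →ₗ[R] K} (hf : ComulModulo c f)
    (h : g - f ∈ multiples c (H →ₗ[R] K)) : ComulModulo c g := by
  obtain ⟨u, hu⟩ := h
  obtain rfl : g = f + c • u := sub_eq_iff_eq_add'.1 hu.symm
  intro a
  have : comul ((f + c • u) a) - TensorProduct.map (f + c • u) (f + c • u) (comul a) =
      (comul (f a) - TensorProduct.map f f (comul a)) +
      c • (comul (u a) - TensorProduct.map f u (comul a) - TensorProduct.map u f (comul a) -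
        c • TensorProduct.map u u (comul a)) := by
    simp only [TensorProduct.map_add_left, TensorProduct.map_add_right,
      TensorProduct.map_smul_left, TensorProduct.map_smul_right, LinearMap.add_apply,
      LinearMap.smul_apply, smul_sub, smul_add, map_add, map_smul]
    abel
  rw [this]
  exact add_mem (hf a) (smul_mem_multiples _ _)

/-- The element `1 - f 1` is an idempotent divisible by `t`, hence by all powers of `t`. -/
theorem map_one_of_map_mul_of_congr [IsHausdorff (Ideal.span {t}) R] [Module.Free R K]
    {f : H →ₗ[R] K} (hmul : ∀ a b, f (a * b) = f a * f b) (h1 : 1 - f 1 ∈ multiples t K) :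
    f 1 = 1 := by
  have hid : (1 - f 1) * (1 - f 1) = 1 - f 1 := by
    have := hmul 1 1
    rw [one_mul] at this
    simp only [mul_sub, sub_mul, one_mul, mul_one, ← this]
    abel
  have : ∀ n, 1 - f 1 ∈ multiples (t ^ n) K := by
    intro n
    induction n with
    | zero => exact ⟨1 - f 1, by simp⟩
    | succ n ih =>
      obtain ⟨u, hu⟩ := ih
      obtain ⟨v, hv⟩ := h1
      refine ⟨u * v, ?_⟩
      rw [← hid]
      nth_rw 1 [← hu]
      rw [← hv]
      change t ^ (n + 1) • (u * v) = (t ^ n • u) * (t • v)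
      rw [smul_mul_smul_comm, pow_succ]
  exact (sub_eq_zero.1 (eq_zero_of_forall_mem_multiples_pow t this)).symm

/-- The functional `ζ = ε ∘ f - ε` satisfies `ζ * ζ = -ζ` for the convolution product and is
divisible by `t`, hence by all powers of `t`. -/
theorem counit_comp_of_map_comul_of_congr [IsHausdorff (Ideal.span {t}) R] {f : H →ₗ[R] K}
    (hcomul : ∀ a, comul (f a) = TensorProduct.map f f (comul a))
    (h1 : ∀ a, t ∣ counit (R := R) (f a) - counit a) (a : H) :
    counit (R := R) (f a) = counit a := by
  let ζ : H →ₗ[R] R := counit ∘ₗ f - counit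
  have hζ : ∀ a, ζ a = counit (f a) - counit a := fun a ↦ rfl
  have h2 : ∀ a, ζ a = - LinearMap.mul' R R (TensorProduct.map ζ ζ (comul a)) := by
    intro a
    have e1 : LinearMap.mul' R R (TensorProduct.map (counit ∘ₗ f) (counit ∘ₗ f) (comul a)) =
        counit (f a) := by
      rw [TensorProduct.map_comp, LinearMap.comp_apply, ← hcomul]
      have := lTensor_counit_comul (R := R) (f a)
      rw [← LinearMap.rTensor_comp_lTensor, LinearMap.comp_apply, this]
      simp
    have e2 : LinearMap.mul' R R (TensorProduct.map (counit ∘ₗ f) counit (comul a)) =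
        counit (f a) := by
      have := lTensor_counit_comul (R := R) a
      rw [← LinearMap.rTensor_comp_lTensor, LinearMap.comp_apply, this]
      simp
    have e3 : LinearMap.mul' R R (TensorProduct.map counit (counit ∘ₗ f) (comul a)) =
        counit (f a) := by
      have := rTensor_counit_comul (R := R) a
      rw [← LinearMap.lTensor_comp_rTensor, LinearMap.comp_apply, this]
      simp
    have e4 : LinearMap.mul' R R (TensorProduct.map counit counit (comul a)) =
        counit (R := R) a := by
      have := rTensor_counit_comul (R := R) a
      rw [← LinearMap.lTensor_comp_rTensor, LinearMap.comp_apply, this]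
      simp
    have e5 : ∀ z : H ⊗[R] H, TensorProduct.map ζ ζ z =
        TensorProduct.map (counit ∘ₗ f) (counit ∘ₗ f) z -
        TensorProduct.map (counit ∘ₗ f) counit z -
        TensorProduct.map counit (counit ∘ₗ f) z + TensorProduct.map counit counit z := by
      intro z
      induction z with
      | zero => simp
      | tmul p q =>
        simp only [TensorProduct.map_tmul, hζ, TensorProduct.sub_tmul, TensorProduct.tmul_sub,
          LinearMap.comp_apply]
        abel
      | add p q hp hq => simp only [map_add, hp, hq]; abel
    rw [e5, map_add, map_sub, map_sub, e1, e2, e3, e4, hζ]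
    ring
  have h3 : ∀ n a, t ^ n ∣ ζ a := by
    intro n
    induction n with
    | zero => simp
    | succ n ih =>
      intro a
      rw [h2, dvd_neg]
      generalize comul (R := R) a = z
      induction z with
      | zero => simp
      | tmul p q =>
        rw [TensorProduct.map_tmul, LinearMap.mul'_apply, pow_succ]
        exact mul_dvd_mul (ih p) (h1 q)
      | add p q hp hq => rw [map_add, map_add]; exact dvd_add hp hq
  have h4 : ζ a = 0 := eq_zero_of_forall_mem_multiples_pow t fun n ↦ by
    obtain ⟨c, hc⟩ := h3 n a
    exact ⟨c, by rw [hc]; rfl⟩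
  exact sub_eq_zero.1 h4

/-- Existence of a lift: start from a linear lift, which is multiplicative and comultiplicative
modulo `t`, improve it from `t ^ n` to `t ^ (n + 1)`, and pass to the `t`-adic limit. -/
theorem exists_bialgHom_lift [IsDomain R] [IsAdicComplete (Ideal.span {t}) R] [Module.Free R H]
    [Module.Finite R H] [Module.Free R K] [Module.Finite R K] (hR : IsResidueField R k t)
    {e : (k ⊗[R] H) ⊗[k] (k ⊗[R] H)}
    (he : ∀ a : k ⊗[R] H, (a ⊗ₜ[k] (1 : k ⊗[R] H)) * e = e * ((1 : k ⊗[R] H) ⊗ₜ[k] a))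
    (he1 : LinearMap.mul' k (k ⊗[R] H) e = 1)
    {lam : k ⊗[R] K →ₗ[k] k} (hlam : IsAdInvariantIntegral lam)
    (φ : k ⊗[R] H →ₐc[k] k ⊗[R] K) :
    ∃ f : H →ₐc[R] K, ∀ a, reduction R k K (f a) = φ (reduction R k H a) := by
  -- The approximations of order `n`.
  let P : ℕ → (H →ₗ[R] K) → Prop := fun n f ↦
    (∀ a, reduction R k K (f a) = φ (reduction R k H a)) ∧ MulModulo (t ^ n) f ∧
      ComulModulo (t ^ n) f
  have hlift : ∀ (n : ℕ) (f g : H →ₗ[R] K), 1 ≤ n →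
      (∀ a, reduction R k K (f a) = φ (reduction R k H a)) →
      ∀ a, reduction R k K ((f + t ^ n • g) a) = φ (reduction R k H a) := by
    intro n f g hn hf a
    rw [LinearMap.add_apply, map_add, hf, LinearMap.smul_apply, hR.reduction_pow_smul hn, add_zero]
  have hstep : ∀ n f, P (n + 1) f → ∃ g, P (n + 2) g ∧
      g - f ∈ multiples (t ^ (n + 1)) (H →ₗ[R] K) := by
    rintro n f ⟨h1, h2, h3⟩
    obtain ⟨g, hg⟩ := exists_mulModulo_succ hR he he1 φ (by omega) f h1 h2
    have h1' := hlift (n + 1) f g (by omega) h1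
    have h3' : ComulModulo (t ^ (n + 1)) (f + t ^ (n + 1) • g) :=
      h3.of_sub_mem (by rw [add_sub_cancel_left]; exact smul_mem_multiples _ _)
    obtain ⟨g', hg', hg''⟩ := exists_comulModulo_succ hR he he1 hlam φ (by omega) _ h1' hg h3'
    refine ⟨_, ⟨hlift (n + 1) _ g' (by omega) h1', hg', hg''⟩, ?_⟩
    rw [add_assoc, add_sub_cancel_left]
    exact add_mem (smul_mem_multiples _ _) (smul_mem_multiples _ _)
  obtain ⟨f₁, hf₁⟩ : ∃ f, P 1 f := by
    obtain ⟨f, hf⟩ := hR.exists_lift (M := H) (N := K) (φ : k ⊗[R] H →ₗ[k] k ⊗[R] K)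
    refine ⟨f, hf, fun a b ↦ ?_, fun a ↦ ?_⟩
    · rw [pow_one, ← hR.reduction_eq_zero_iff (k := k), map_sub, hf, reduction_mul,
        reduction_mul, hf, hf, sub_eq_zero]
      exact map_mul φ _ _
    · rw [pow_one, ← hR.reduction₂_eq_zero_iff (k := k), map_sub, ← comul_reduction, hf,
        reduction₂_map hf hf, ← comul_reduction, sub_eq_zero]
      exact (CoalgHomClass.map_comp_comul_apply φ _).symm
  choose! S hS hS' using hstep
  let F : ℕ → (H →ₗ[R] K) := fun n ↦ Nat.rec f₁ (fun n f ↦ S n f) n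
  have hF : ∀ n, P (n + 1) (F n) := by
    intro n
    induction n with
    | zero => exact hf₁
    | succ n ih => exact hS n _ ih
  have hF' : ∀ n, F (n + 1) - F n ∈ multiples (t ^ n) (H →ₗ[R] K) := fun n ↦
    multiples_mono (pow_dvd_pow t (Nat.le_succ n)) (hS' n _ (hF n))
  obtain ⟨L, hL⟩ := exists_limit t F hF'
  have hmul : ∀ a b, L (a * b) = L a * L b := fun a b ↦ by
    refine sub_eq_zero.1 (eq_zero_of_forall_mem_multiples_pow t fun n ↦ ?_)
    refine MulModulo.of_sub_mem (f := F n) (fun a b ↦ ?_) (hL n) a b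
    exact multiples_mono (pow_dvd_pow t (Nat.le_succ n)) ((hF n).2.1 a b)
  have hcomul : ∀ a, comul (L a) = TensorProduct.map L L (comul a) := fun a ↦ by
    refine sub_eq_zero.1 (eq_zero_of_forall_mem_multiples_pow t fun n ↦ ?_)
    refine ComulModulo.of_sub_mem (f := F n) (fun a ↦ ?_) (hL n) a
    exact multiples_mono (pow_dvd_pow t (Nat.le_succ n)) ((hF n).2.2 a)
  have hred : ∀ a, reduction R k K (L a) = φ (reduction R k H a) := fun a ↦ by
    obtain ⟨u, hu⟩ := hL 1
    obtain rfl : L = F 1 + t ^ 1 • u := sub_eq_iff_eq_add'.1 hu.symm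
    exact hlift 1 _ u le_rfl (hF 1).1 a
  have hone : L 1 = 1 := by
    refine map_one_of_map_mul_of_congr (t := t) hmul ?_
    rw [← hR.reduction_eq_zero_iff (k := k), map_sub, hred, reduction_one, reduction_one,
      map_one φ, sub_self]
  have hcounit : ∀ a, counit (R := R) (L a) = counit a := by
    refine counit_comp_of_map_comul_of_congr (t := t) hcomul fun a ↦ ?_
    rw [← hR.algebraMap_eq_zero_iff, map_sub, ← counit_reduction, ← counit_reduction, hred,
      CoalgHomClass.counit_comp_apply, sub_self]
  exact ⟨BialgHom.ofAlgHom (AlgHom.ofLinearMap L hone hmul)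
    (AlgHom.ext hcounit) (AlgHom.ext fun a ↦ by
      exact (hcomul a).symm), hred⟩

/-- Uniqueness of the lift: if two lifts differ by `t ^ n u`, then the reduction of `u` is a
derivation and a coderivation along `φ`, so it vanishes and `u` is divisible by `t`. -/
theorem bialgHom_ext_of_reduction [IsDomain R] [IsHausdorff (Ideal.span {t}) R] [Module.Free R H]
    [Module.Free R K] (hR : IsResidueField R k t)
    {e : (k ⊗[R] H) ⊗[k] (k ⊗[R] H)}
    (he : ∀ a : k ⊗[R] H, (a ⊗ₜ[k] (1 : k ⊗[R] H)) * e = e * ((1 : k ⊗[R] H) ⊗ₜ[k] a))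
    (he1 : LinearMap.mul' k (k ⊗[R] H) e = 1)
    {lam : k ⊗[R] K →ₗ[k] k} (hlam : IsAdInvariantIntegral lam)
    (φ : k ⊗[R] H →ₐc[k] k ⊗[R] K) {f g : H →ₐc[R] K}
    (hf : ∀ a, reduction R k K (f a) = φ (reduction R k H a))
    (hg : ∀ a, reduction R k K (g a) = φ (reduction R k H a)) : f = g := by
  have h : ∀ n, ∃ u : H →ₗ[R] K, ∀ a, t ^ (n + 1) • u a = f a - g a := by
    intro n
    induction n with
    | zero =>
      obtain ⟨u, hu⟩ := exists_smul_eq_of_forall_mem_multiples (c := t)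
        ((f : H →ₗ[R] K) - (g : H →ₗ[R] K)) (fun a ↦ by
          rw [← hR.reduction_eq_zero_iff (k := k), LinearMap.sub_apply, map_sub, sub_eq_zero]
          exact (hf a).trans (hg a).symm)
      exact ⟨u, fun a ↦ by simpa using LinearMap.congr_fun hu a⟩
    | succ n ih =>
      obtain ⟨u, hu⟩ := ih
      have htn : t ^ (n + 1) ≠ 0 := pow_ne_zero _ hR.ne_zero
      let d : k ⊗[R] H →ₗ[k] k ⊗[R] K := u.baseChange k
      have hd : ∀ a, reduction R k K (u a) = d (reduction R k H a) := fun a ↦ by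
        simp [d, reduction_apply]
      have hleib : ∀ a b, u (a * b) = f a * u b + u a * g b := by
        intro a b
        refine smul_right_injective K htn ?_
        change t ^ (n + 1) • _ = t ^ (n + 1) • _
        rw [hu, smul_add, ← mul_smul_comm, ← smul_mul_assoc, hu, hu, map_mul, map_mul, mul_sub,
          sub_mul]
        abel
      have hcoleib : ∀ a, comul (u a) = TensorProduct.map (f : H →ₗ[R] K) u (comul a) +
          TensorProduct.map u (g : H →ₗ[R] K) (comul a) := by
        intro a
        refine smul_right_injective (K ⊗[R] K) htn ?_
        change t ^ (n + 1) • _ = t ^ (n + 1) • _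
        have h1 : ∀ z : H ⊗[R] H, t ^ (n + 1) • (TensorProduct.map (f : H →ₗ[R] K) u z +
            TensorProduct.map u (g : H →ₗ[R] K) z) =
            TensorProduct.map (f : H →ₗ[R] K) (f : H →ₗ[R] K) z -
            TensorProduct.map (g : H →ₗ[R] K) (g : H →ₗ[R] K) z := by
          intro z
          induction z with
          | zero => simp
          | tmul p q =>
            simp only [TensorProduct.map_tmul]
            rw [smul_add, ← TensorProduct.tmul_smul, TensorProduct.smul_tmul', hu, hu,
              TensorProduct.tmul_sub, TensorProduct.sub_tmul]
            exact sub_add_sub_cancel _ _ _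
          | add p q hp hq =>
            simp only [map_add]
            rw [add_add_add_comm, smul_add, hp, hq]
            abel
        rw [h1, ← map_smul, hu, map_sub]
        exact congrArg₂ (· - ·) (CoalgHomClass.map_comp_comul_apply f a).symm
          (CoalgHomClass.map_comp_comul_apply g a).symm
      have hd0 : d = 0 := by
        refine eq_zero_of_leibniz_of_coleibniz he he1 hlam φ d ?_ ?_
        · intro a b
          obtain ⟨a, rfl⟩ := hR.reduction_surjective a
          obtain ⟨b, rfl⟩ := hR.reduction_surjective b
          rw [← reduction_mul, ← hd, ← hd, ← hd, hleib, map_add, reduction_mul, reduction_mul,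
            hf, hg]
        · intro a
          obtain ⟨a, rfl⟩ := hR.reduction_surjective a
          rw [← hd, comul_reduction, comul_reduction, hcoleib, map_add]
          exact congrArg₂ (· + ·)
            (reduction₂_map (φ := (φ : k ⊗[R] H →ₗ[k] k ⊗[R] K)) hf hd _)
            (reduction₂_map (γ := (φ : k ⊗[R] H →ₗ[k] k ⊗[R] K)) hd hg _)
      obtain ⟨v, hv⟩ := exists_smul_eq_of_forall_mem_multiples (c := t) u (fun a ↦ by
        rw [← hR.reduction_eq_zero_iff (k := k), hd, hd0, LinearMap.zero_apply])
      refine ⟨v, fun a ↦ ?_⟩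
      rw [pow_succ, mul_smul, ← hu, ← hv, LinearMap.smul_apply]
  refine BialgHom.ext fun a ↦ sub_eq_zero.1 (eq_zero_of_forall_mem_multiples_pow t fun n ↦ ?_)
  obtain ⟨u, hu⟩ := h n
  rw [← hu]
  exact multiples_mono (pow_dvd_pow t (Nat.le_succ n)) (smul_mem_multiples _ _)

end Main

/-! ### Liftings to Witt vectors -/

theorem wittVector_isResidueField (p : ℕ) [Fact p.Prime] (k : Type*) [Field k] [IsAlgClosed k]
    [CharP k p] : IsResidueField (WittVector p k) k (p : WittVector p k) where
  ne_zero := WittVector.p_nonzero p k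
  surjective := WittVector.constantCoeff_surjective p
  algebraMap_eq_zero_iff := fun x ↦ by
    rw [← Ideal.mem_span_singleton, WittVector.mem_span_p_iff_coeff_zero_eq_zero]
    rfl

/-- The integral property is transported along an isomorphism of Hopf algebras. -/
theorem applyLeft_comul_comp {k A B : Type*} [Field k] [Ring A] [HopfAlgebra k A] [Ring B]
    [HopfAlgebra k B] (σ : A ≃ₐc[k] B) {lam : B →ₗ[k] k}
    (h : ∀ b, applyLeft lam B (comul b) = lam b • 1) (a : A) :
    applyLeft (lam ∘ₗ (σ : A →ₗ[k] B)) A (comul a) = (lam ∘ₗ (σ : A →ₗ[k] B)) a • 1 := by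
  apply EquivLike.injective σ
  have h1 : ∀ z : A ⊗[k] A, σ (applyLeft (lam ∘ₗ (σ : A →ₗ[k] B)) A z) =
      applyLeft lam B (TensorProduct.map (σ : A →ₗ[k] B) (σ : A →ₗ[k] B) z) := by
    intro z
    induction z with
    | zero => simp
    | tmul p q => simp
    | add p q hp hq => simp only [map_add, hp, hq]
  have h2 : TensorProduct.map (σ : A →ₗ[k] B) (σ : A →ₗ[k] B) (comul a) = comul (σ a) :=
    CoalgHomClass.map_comp_comul_apply σ a
  rw [h1, h2, h, map_smul, map_one]
  rfl

theorem theorem2p2 (p : ℕ) [Fact p.Prime] (k : Type*) [Field k] [IsAlgClosed k] [CharP k p]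
    (A B : Type*) [Ring A] [Ring B] [HopfAlgebra k A] [HopfAlgebra k B]
    [Module.Finite k A] [Module.Finite k B]
    (hA : IsSemisimpleRing A) (hA' : IsCosemisimple k A)
    (hB : IsSemisimpleRing B) (hB' : IsCosemisimple k B)
    (φ : HopfHom k A B)
    (Abar Bbar : Type*) [Ring Abar] [Ring Bbar]
    [HopfAlgebra (WittVector p k) Abar] [HopfAlgebra (WittVector p k) Bbar]
    (lA : HopfLifting p k A Abar) (lB : HopfLifting p k B Bbar) :
    ∃! φbar : HopfHom (WittVector p k) Abar Bbar,
      ∀ x : Abar, lB.red (φbar.toBialgHom x) = φ.toBialgHom (lA.red x) := by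
  have := lA.free
  have := lA.finite
  have := lB.free
  have := lB.finite
  have hR := wittVector_isResidueField p k
  have : IsSemisimpleRing (k ⊗[WittVector p k] Abar) :=
    RingEquiv.isSemisimpleRing (lA.equiv : _ ≃ₐ[k] A).symm.toRingEquiv
  have : IsSemisimpleRing (k ⊗[WittVector p k] Bbar) :=
    RingEquiv.isSemisimpleRing (lB.equiv : _ ≃ₐ[k] B).symm.toRingEquiv
  obtain ⟨e, he, he1⟩ := exists_separability_element (k := k) (A := k ⊗[WittVector p k] Abar)
  obtain ⟨lam, hlam1, hlam⟩ := hB'.exists_integral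
  have hint : IsAdInvariantIntegral
      (lam ∘ₗ (lB.equiv : k ⊗[WittVector p k] Bbar →ₗ[k] B)) := by
    refine isAdInvariantIntegral_of_isSemisimpleRing ?_ (applyLeft_comul_comp lB.equiv hlam)
    rw [LinearMap.comp_apply]
    exact (congrArg lam (map_one lB.equiv)).trans hlam1
  let φ' : k ⊗[WittVector p k] Abar →ₐc[k] k ⊗[WittVector p k] Bbar :=
    ((lB.equiv.symm : B →ₐc[k] _).comp φ.toBialgHom).comp (lA.equiv : _ →ₐc[k] A)
  have hφ' : ∀ (ψ : Abar →ₐc[WittVector p k] Bbar),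
      (∀ a, reduction (WittVector p k) k Bbar (ψ a) = φ' (reduction (WittVector p k) k Abar a)) ↔
      ∀ x, lB.red (ψ x) = φ.toBialgHom (lA.red x) := by
    intro ψ
    refine forall_congr' fun x ↦ ?_
    exact lB.equiv.toEquiv.eq_symm_apply
  obtain ⟨f, hf⟩ := exists_bialgHom_lift hR he he1 hint φ'
  refine ⟨⟨f, BialgHom.map_antipode f⟩, (hφ' f).1 hf, ?_⟩
  rintro ⟨g, hg'⟩ hg
  obtain rfl : g = f := bialgHom_ext_of_reduction hR he he1 hint φ' ((hφ' g).2 hg) hf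
  rfl
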